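/- **Setting.** Let $d\ge 2$, $\lambda\ge 1$, $\alpha>0$, $\kappa\ge 1$, $0<c\le 1/2$, $n\in\mathbb N^*$ and $0<\delta<1$. Write $\lceil\alpha\rceil$ for the least integer $\ge\alpha$, $\lfloor\alpha\rfloor$ for the largest integer *strictly* smaller than $\alpha$, and $m=\max(1,\lfloor\alpha\rfloor)$. Points of $[0,1]^d$ are written $x=(\tilde x,x_d)\in[0,1]^{d-1}\times[0,1]$. *Problem class.* $\Sigma(\lambda,\alpha)$ is the set of $\lfloor\alpha\rfloor$ times continuously differentiable $g:[0,1]^{d-1}\to[0,1]$ such that $|g(x)-\mathrm{TP}_{y,\lfloor\beta\rfloor}(x)|\le\lambda\|x-y\|_\infty^\beta$ for all $x,y\in[0,1]^{d-1}$ and all $0<\beta\le\alpha$, where $\mathrm{TP}_{y,k}$ is the Taylor polynomial of $g$ of degree $k$ at $y$. A classification problem on $[0,1]^d$ with labels in $\{0,1\}$ and regression function $\eta(x)=\mathbb P(Y=1\mid X=x)$ belongs to $\mathcal P(\alpha,\kappa)=\mathcal P(\lambda,\alpha,\kappa,c)$ if there is $g^*\in\Sigma(\lambda,\alpha)$ with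 $\{x:\eta(x)\ge 1/2\}=\{x:x_d\ge g^*(\tilde x)\}$ and $|\eta(x)-\tfrac12|\ge c\,|x_d-g^*(\tilde x)|^{\kappa-1}$ for all $x\in[0,1]^d$. A learner may request labels at points of its choice; each requested label at $x$ is a fresh Bernoulli$(\eta(x))$ variable, independent of the other labels. *Line search* with precision $\epsilon$ and confidence $\delta'$ along $\{\tilde x\}\times[0,1]$: put $K=\max(0,\lceil\log_2\frac1{2\epsilon}\rceil)$ and $[L_1,R_1]=[0,1]$. For $k=1,\dots,K$, let $U_k,M_k,V_k$ be the quartiles of $[L_k,R_k]$ in increasing order and $\delta_k=\delta'/(K2^k)$. In rounds $t=1,2,\dots$ request one label at each of $(\tilde x,U_k),(\tilde x,M_k),(\tilde x,V_k)$; let $\hat\eta_t(Z)$ be the mean of the $t$ labels received at $(\tilde x,Z)$ in this epoch and $w_t=2\sqrt{\log(t/\delta_k)/(2t)}$. The epoch ends at the first $t$ with $|\hat\eta_t(M_k)-\frac12|\ge w_t$, in which case $[L_{k+1},R_{k+1}]$ is $[L_k,M_k]$ if $\hat\eta_t(M_k)>\frac12$ and $[M_k,R_k]$ otherwise; or with $\hat\eta_t(V_k)-\frac12\ge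 w_t$ and $\frac12-\hat\eta_t(U_k)\ge w_t$, in which case (if the first condition fails) $[L_{k+1},R_{k+1}]=[U_k,V_k]$. The output is the midpoint $T$ of the last interval. *Algorithm 2* with inputs $n,\delta,\lambda,\alpha$: for $l=1,2,\dots$, as long as the budget of $n$ labels is not exhausted, put $M_l=m2^l$, $\epsilon_l=\lambda2^{-l\alpha}$, $\delta_l=\delta/(m2^{l(d+1)})$, and for each $\tilde a\in\{0,\dots,M_l\}^{d-1}$ run the line search with parameters $\epsilon_l,\delta_l$ along $\{M_l^{-1}\tilde a\}\times[0,1]$, giving $T_{l,\tilde a}$. The run is interrupted when the budget is exhausted; $l^*$ is the last depth at which all line searches were completed. If no depth was completed, output $S^0=S^1=\emptyset$. Otherwise split $[0,1]^{d-1}$ into the $2^{l^*(d-1)}$ cells of side $2^{-l^*}$, and let $\widehat P$ be, on the cell with lower corner $2^{-l^*}\tilde q$, the tensor-product Lagrange polynomial of degree $\lfloor\alpha\rfloor$ in each variable with the values $T_{l^*,\tilde a}$ at the nodes $M_{l^*}^{-1}\tilde a$, $\tilde a\in m\tilde q+\{0,\dots,\lfloor\alpha\rfloor\}^{d-1}$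 (for $\alpha\le 1$: the constant $T_{l^*,\tilde q}$). With $b=\lambda\lceil\alpha\rceil^{d\lceil\alpha\rceil}M_{l^*}^{-\alpha}$, output $S^0=\{x\in[0,1]^d:x_d\le\widehat P(\tilde x)-4b\}$ and $S^1=\{x\in[0,1]^d:x_d\ge\widehat P(\tilde x)+4b\}$. (The parameters $\kappa$ and $c$ are not used.) *Correctness.* For $\Delta\ge 0$, a procedure that returns disjoint measurable sets $S^0,S^1\subset[0,1]^d$ is $(\delta,\Delta,n)$-correct if, with probability larger than $1-2\delta$, it makes at most $n$ label requests and $$\{x_d-g^*(\tilde x)>\Delta\}\subset S^1\subset\{x_d>g^*(\tilde x)\},\qquad \{g^*(\tilde x)-x_d>\Delta\}\subset S^0\subset\{x_d<g^*(\tilde x)\}.$$ **Theorem.** Algorithm 2, run with parameters $n,\delta,\lambda,\alpha$ on any problem in $\mathcal P(\lambda,\alpha,\kappa,c)$, is $(\delta,\Delta_n,n)$-correct for some $\Delta_n\ge 0$ which, if $\kappa>1$, satisfies $$\Delta_n\le 7\lceil\alpha\rceil^{d\lceil\alpha\rceil}\,2^\alpha\,\lambda^{\frac{d-1}{2\alpha(\kappa-1)+d-1}}\Big(\frac{\log(n/\delta)}{c_1n}\Big)^{\frac{\alpha}{2\alpha(\kappa-1)+d-1}},\qquad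 c_1=\frac{(\kappa-1)c^2}{400\,(2\lceil\alpha\rceil)^{d-1}\,\alpha\,\log(1/c)\,\kappa\,8^{2(\kappa-1)}}.$$ (For $\kappa=1$ one has $c_1=0$ and the bound is void.) -/

import Mathlib

open MeasureTheory ProbabilityTheory

noncomputable section

namespace ActiveLearning

/-- The largest integer strictly smaller than `a` (for `0 < a`). -/
def strictFloor (a : ℝ) : ℕ := ⌈a⌉₊ - 1

/-- The unit cube `[0,1]^(d-1)`; the norm on `Fin (d - 1) → ℝ` is the sup norm. -/
def baseCube (d : ℕ) : Set (Fin (d - 1) → ℝ) := Set.Icc 0 1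

/-- Points `x = (x̃, x_d)` of `ℝ^(d-1) × ℝ`. -/
abbrev Point (d : ℕ) : Type := (Fin (d - 1) → ℝ) × ℝ

/-- The feature space `[0,1]^d = [0,1]^(d-1) × [0,1]`. -/
def cube (d : ℕ) : Set (Point d) := baseCube d ×ˢ Set.Icc (0 : ℝ) 1

/-! ### The nonparametric class -/

/-- Taylor polynomial of degree `k` of `g` at `y`, evaluated at `x`. -/
def taylorPoly {d : ℕ} (g : (Fin (d - 1) → ℝ) → ℝ) (k : ℕ) (y x : Fin (d - 1) → ℝ) : ℝ :=
  ∑ j ∈ Finset.range (k + 1),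
    (1 / (j.factorial : ℝ)) * iteratedFDerivWithin ℝ j g (baseCube d) y (fun _ => x - y)

/-- The Hölder class `Σ(lam, α)` of functions `[0,1]^(d-1) → [0,1]`. -/
structure HolderClass (d : ℕ) (lam α : ℝ) (g : (Fin (d - 1) → ℝ) → ℝ) : Prop where
  mapsTo : Set.MapsTo g (baseCube d) (Set.Icc 0 1)
  contDiffOn : ContDiffOn ℝ (strictFloor α) g (baseCube d)
  taylor : ∀ β : ℝ, 0 < β → β ≤ α → ∀ x ∈ baseCube d, ∀ y ∈ baseCube d,
    |g x - taylorPoly g (strictFloor β) y x| ≤ lam * ‖x - y‖ ^ β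

/-- A binary classification problem on `[0,1]^d`, given by the marginal law of `X` and the
regression function `η(x) = P(Y = 1 | X = x)`. -/
structure ClassificationProblem (d : ℕ) where
  marginal : Measure (Point d)
  isProbabilityMeasure : IsProbabilityMeasure marginal
  support : marginal (cube d)ᶜ = 0
  eta : Point d → ℝ
  measurable_eta : Measurable eta
  eta_mem : ∀ x ∈ cube d, eta x ∈ Set.Icc (0 : ℝ) 1

/-- The problem belongs to the class `𝒫(lam, α, κ, c)`, with decision boundary (the graph of)
`g`: the set `{η ≥ 1/2}` is the epigraph of `g ∈ Σ(lam, α)`, and the geometric noise condition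
holds with constants `κ` and `c`. -/
structure InClass {d : ℕ} (P : ClassificationProblem d) (lam α κ c : ℝ)
    (g : (Fin (d - 1) → ℝ) → ℝ) : Prop where
  holder : HolderClass d lam α g
  epigraph : {x ∈ cube d | 1 / 2 ≤ P.eta x} = {x ∈ cube d | g x.1 ≤ x.2}
  noise : ∀ x ∈ cube d, c * |x.2 - g x.1| ^ (κ - 1) ≤ |P.eta x - 1 / 2|

/-! ### Label requests -/

/-- The address of a label request in a run of the algorithm: depth of the grid, line of that
grid, epoch of the line search, which of the three points `U, M, V` of the epoch
(`0`, `1`, `2` in this order), and round of the epoch. In a run every address is used at most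
once, so each request gets a fresh label. -/
structure Request (d : ℕ) where
  depth : ℕ
  line : Fin (d - 1) → ℕ
  epoch : ℕ
  point : Fin 3
  round : ℕ

/-- Label oracle: `Y r x` is the label revealed if request `r` is made at the point `x`. It is
`1` (`true`) with probability `η(x)`, and the answers to distinct requests are independent. -/
structure IsLabelOracle {d : ℕ} {Ω : Type*} [MeasurableSpace Ω] (P : ClassificationProblem d)
    (μ : Measure Ω) (Y : Request d → Point d → Ω → Bool) : Prop where
  measurable : ∀ r x, Measurable (Y r x)
  law : ∀ r, ∀ x ∈ cube d, μ {ω | Y r x ω = true} = ENNReal.ofReal (P.eta x)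
  indep : iIndepFun (fun r ω x => Y r x ω) μ

/-! ### The line search

A run of a procedure with a budget of `B` labels returns the number of labels it requested,
together with its result, or `none` if the budget ran out before it terminated. -/

/-- Confidence term `2 √(log (t / δ) / (2 t))`. -/
def conf (δ : ℝ) (t : ℕ) : ℝ := 2 * Real.sqrt (Real.log (t / δ) / (2 * t))

/-- Empirical mean of the first `t` labels. -/
def empMean (y : ℕ → Bool) (t : ℕ) : ℝ :=
  (∑ i ∈ Finset.range t, if y i then (1 : ℝ) else 0) / t

/-- The middle point is confidently labelled after `t` rounds. -/
def MidDecided (yM : ℕ → Bool) (δ : ℝ) (t : ℕ) : Prop :=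
  conf δ t ≤ |empMean yM t - 1 / 2|

/-- Both outer points are confidently labelled after `t` rounds, `V` by `1` and `U` by `0`. -/
def OuterDecided (yU yV : ℕ → Bool) (δ : ℝ) (t : ℕ) : Prop :=
  conf δ t ≤ empMean yV t - 1 / 2 ∧ conf δ t ≤ 1 / 2 - empMean yU t

open Classical in
/-- One epoch on the interval `[I.1, I.2]`. Each round requests three labels, one at each
quartile; `y j i z` is the answer in round `i` at the `j`-th of the points `U, M, V`, which is
`z`. The result is the next interval. -/
def epochRun (y : Fin 3 → ℕ → ℝ → Bool) (δ : ℝ) (I : ℝ × ℝ) (B : ℕ) : ℕ × Option (ℝ × ℝ) :=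
  let M := (I.1 + I.2) / 2
  let U := (I.2 - I.1) / 4 + I.1
  let V := (I.2 - I.1) / 4 + M
  let yU := fun i => y 0 i U
  let yM := fun i => y 1 i M
  let yV := fun i => y 2 i V
  if h : ∃ t, 1 ≤ t ∧ 3 * t ≤ B ∧ (MidDecided yM δ t ∨ OuterDecided yU yV δ t) then
    let t := Nat.find h
    (3 * t, some (if MidDecided yM δ t then
        (if 1 / 2 < empMean yM t then (I.1, M) else (M, I.2))
      else (U, V)))
  else (3 * (B / 3), none)

/-- The first `k` epochs of the line search on `[0,1]`; epoch `k` has confidence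
parameter `δ / (K 2^k)`. -/
def epochs (y : ℕ → Fin 3 → ℕ → ℝ → Bool) (δ : ℝ) (K B : ℕ) : ℕ → ℕ × Option (ℝ × ℝ)
  | 0 => (0, some (0, 1))
  | k + 1 =>
    match epochs y δ K B k with
    | (N, none) => (N, none)
    | (N, some I) =>
      let r := epochRun (y (k + 1)) (δ / (K * 2 ^ (k + 1))) I (B - N)
      (N + r.1, r.2)

/-- Number of epochs `⌈log₂ (1 / (2 ε))⌉` (none if this is not positive). -/
def numEpochs (ε : ℝ) : ℕ := ⌈Real.logb 2 (1 / (2 * ε))⌉₊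

/-- The line search with precision `ε` and confidence `δ`; the result is the threshold estimate,
the midpoint of the final interval. -/
def lineSearch (y : ℕ → Fin 3 → ℕ → ℝ → Bool) (ε δ : ℝ) (B : ℕ) : ℕ × Option ℝ :=
  let r := epochs y δ (numEpochs ε) B (numEpochs ε)
  (r.1, r.2.map fun I => (I.1 + I.2) / 2)

/-! ### The `κ`-adaptive procedure in dimension `d` -/

/-- `max(1, ⌊α⌋)`, with `⌊α⌋` the largest integer strictly smaller than `α`. -/
def cellNodes (α : ℝ) : ℕ := max 1 (strictFloor α)

/-- Number of grid steps per axis at depth `l`. -/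
def gridSize (α : ℝ) (l : ℕ) : ℕ := cellNodes α * 2 ^ l

/-- Precision of the line searches at depth `l`. -/
def precision (lam α : ℝ) (l : ℕ) : ℝ := lam * (2 : ℝ) ^ (-(l * α))

/-- Confidence parameter of the line searches at depth `l`. -/
def depthConf (d : ℕ) (δ α : ℝ) (l : ℕ) : ℝ := δ / (cellNodes α * 2 ^ (l * (d + 1)))

/-- Grid point `M_l⁻¹ a`. -/
def gridPoint {d : ℕ} (α : ℝ) (l : ℕ) (a : Fin (d - 1) → ℕ) : Fin (d - 1) → ℝ :=
  fun i => (a i : ℝ) / gridSize α l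

/-- Indices `{0, …, M_l}^(d-1)` of the lines at depth `l`. -/
def lineIndices (d : ℕ) (α : ℝ) (l : ℕ) : Finset (Fin (d - 1) → ℕ) :=
  Fintype.piFinset fun _ => Finset.range (gridSize α l + 1)

/-- Line search along `{M_l⁻¹ a} × [0,1]`, when the oracle answers are `y`. -/
def searchLine {d : ℕ} (y : Request d → Point d → Bool) (δ lam α : ℝ) (l : ℕ)
    (a : Fin (d - 1) → ℕ) (B : ℕ) : ℕ × Option ℝ :=
  lineSearch (fun k j i z => y ⟨l, a, k, j, i⟩ (gridPoint α l a, z))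
    (precision lam α l) (depthConf d δ α l) B

/-- Line searches along a list of lines, one after the other with the common budget `B`; the
result is the map from lines to threshold estimates. -/
def searchLines {d : ℕ} (y : Request d → Point d → Bool) (δ lam α : ℝ) (l B : ℕ) :
    List (Fin (d - 1) → ℕ) → ℕ × Option ((Fin (d - 1) → ℕ) → ℝ)
  | [] => (0, some 0)
  | a :: as =>
    match searchLines y δ lam α l B as with
    | (N, none) => (N, none)
    | (N, some T) =>
      let r := searchLine y δ lam α l a (B - N)
      (N + r.1, r.2.map fun τ => Function.update T a τ)

/-- State after passes `1, …, l` of the main loop with budget `n`: the number of labels requested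
so far, and the threshold estimates at depth `l` if that depth was completed. -/
def mainLoop {d : ℕ} (y : Request d → Point d → Bool) (n : ℕ) (δ lam α : ℝ) :
    ℕ → ℕ × Option ((Fin (d - 1) → ℕ) → ℝ)
  | 0 => (0, some 0)
  | l + 1 =>
    match mainLoop y n δ lam α l with
    | (t, none) => (t, none)
    | (t, some _) =>
      if t < n then
        let r := searchLines y δ lam α (l + 1) (n - t) (lineIndices d α (l + 1)).toList
        (t + r.1, r.2)
      else (t, none)

/-- The last completed depth `l*` (`0` if not even depth `1` was completed). The completed depths
form an initial segment, which is finite because deep searches cost labels. -/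
def finalDepth {d : ℕ} (y : Request d → Point d → Bool) (n : ℕ) (δ lam α : ℝ) : ℕ :=
  sSup {l | (mainLoop y n δ lam α l).2.isSome}

/-- Total number of labels requested, including those of the depth that was not completed. -/
def labelsRequested {d : ℕ} (y : Request d → Point d → Bool) (n : ℕ) (δ lam α : ℝ) : ℕ :=
  (mainLoop y n δ lam α (finalDepth y n δ lam α + 1)).1

/-- Threshold estimates at the last completed depth. -/
def thresholds {d : ℕ} (y : Request d → Point d → Bool) (n : ℕ) (δ lam α : ℝ) :
    (Fin (d - 1) → ℕ) → ℝ :=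
  ((mainLoop y n δ lam α (finalDepth y n δ lam α)).2).getD 0

/-- Index `q ∈ {0, …, 2^l - 1}^(d-1)` of the cell of side `2^(-l) = max(1,⌊α⌋) / M_l` that
contains `x`. -/
def cellIndex {d : ℕ} (l : ℕ) (x : Fin (d - 1) → ℝ) : Fin (d - 1) → ℕ :=
  fun i => min ⌊x i * 2 ^ l⌋₊ (2 ^ l - 1)

/-- Tensor-product Lagrange polynomial, in the cell `q`, of the node `a = max(1,⌊α⌋) q + j`, where
`j ∈ {0, …, ⌊α⌋}^(d-1)`. -/
def lagrangeBasis {d : ℕ} (α : ℝ) (l : ℕ) (q j : Fin (d - 1) → ℕ) (x : Fin (d - 1) → ℝ) : ℝ :=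
  ∏ i, ∏ j' ∈ (Finset.range (strictFloor α + 1)).erase (j i),
    (x i - ((cellNodes α * q i + j' : ℕ) : ℝ) / gridSize α l) /
      (((cellNodes α * q i + j i : ℕ) : ℝ) / gridSize α l -
        ((cellNodes α * q i + j' : ℕ) : ℝ) / gridSize α l)

/-- Piecewise tensor-product Lagrange interpolation of degree `⌊α⌋` of the thresholds `T` at depth
`l`. For `α ≤ 1` it is constant on each cell, with the value at the lower corner. -/
def interpolant {d : ℕ} (α : ℝ) (l : ℕ) (T : (Fin (d - 1) → ℕ) → ℝ) (x : Fin (d - 1) → ℝ) : ℝ :=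
  ∑ j ∈ Fintype.piFinset (fun _ : Fin (d - 1) => Finset.range (strictFloor α + 1)),
    T (fun i => cellNodes α * cellIndex l x i + j i) * lagrangeBasis α l (cellIndex l x) j x

/-- Bias term `b_l`. -/
def bias (d : ℕ) (lam α : ℝ) (l : ℕ) : ℝ :=
  lam * (⌈α⌉₊ : ℝ) ^ (d * ⌈α⌉₊) * (gridSize α l : ℝ) ^ (-α)

/-- The set labelled `0` by the algorithm; everything is left unlabelled if no depth was
completed. -/
def outputZero {d : ℕ} (y : Request d → Point d → Bool) (n : ℕ) (δ lam α : ℝ) :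
    Set (Point d) :=
  let l := finalDepth y n δ lam α
  {x ∈ cube d | 1 ≤ l ∧
    x.2 ≤ interpolant α l (thresholds y n δ lam α) x.1 - 4 * bias d lam α l}

/-- The set labelled `1` by the algorithm. -/
def outputOne {d : ℕ} (y : Request d → Point d → Bool) (n : ℕ) (δ lam α : ℝ) :
    Set (Point d) :=
  let l := finalDepth y n δ lam α
  {x ∈ cube d | 1 ≤ l ∧
    interpolant α l (thresholds y n δ lam α) x.1 + 4 * bias d lam α l ≤ x.2}

/-! ### Correctness -/

/-- A procedure with random outputs `S₀`, `S₁`, which makes `N` label requests, is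
`(δ, Δ, n)`-correct for a problem with decision boundary `g`: its outputs are disjoint measurable
subsets of the cube and, with probability larger than `1 - 2 δ`, it makes at most `n` requests,
labels every point at vertical distance more than `Δ` from the boundary, and makes no mistake. -/
structure IsCorrect {d : ℕ} {Ω : Type*} [MeasurableSpace Ω] (μ : Measure Ω)
    (S₀ S₁ : Ω → Set (Point d)) (N : Ω → ℕ) (g : (Fin (d - 1) → ℝ) → ℝ)
    (δ Δ : ℝ) (n : ℕ) : Prop where
  nonneg : 0 ≤ Δ
  subset_zero : ∀ ω, S₀ ω ⊆ cube d
  subset_one : ∀ ω, S₁ ω ⊆ cube d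
  disjoint : ∀ ω, Disjoint (S₀ ω) (S₁ ω)
  measurable_zero : ∀ ω, MeasurableSet (S₀ ω)
  measurable_one : ∀ ω, MeasurableSet (S₁ ω)
  prob : μ {ω | ¬ (N ω ≤ n ∧
      {x ∈ cube d | Δ < x.2 - g x.1} ⊆ S₁ ω ∧
      {x ∈ cube d | Δ < g x.1 - x.2} ⊆ S₀ ω ∧
      S₁ ω ⊆ {x ∈ cube d | g x.1 < x.2} ∧
      S₀ ω ⊆ {x ∈ cube d | x.2 < g x.1})} < ENNReal.ofReal (2 * δ)

/-- The constant `c₁`. -/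
def c₁ (d : ℕ) (α κ c : ℝ) : ℝ :=
  (κ - 1) * c ^ 2 /
    (400 * (2 * (⌈α⌉₊ : ℝ)) ^ (d - 1) * α * Real.log (1 / c) * κ * (8 : ℝ) ^ (2 * (κ - 1)))

/-- The bound on the half-width `Δ_n` of the abstention region. -/
def widthBound (d n : ℕ) (δ lam α κ c : ℝ) : ℝ :=
  7 * (⌈α⌉₊ : ℝ) ^ (d * ⌈α⌉₊) * (2 : ℝ) ^ α *
    lam ^ (((d : ℝ) - 1) / (2 * α * (κ - 1) + d - 1)) *
    (Real.log (n / δ) / (c₁ d α κ c * n)) ^ (α / (2 * α * (κ - 1) + d - 1))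

end ActiveLearning

end

open ActiveLearning

/-!
On the event that every empirical mean of every completed depth stays within its confidence width
of `η`, each line search terminates and locates `g*` up to `ε_l`. As
`conf δ t = 2 √(log (t / δ) / (2 t))`, Hoeffding's inequality bounds each deviation probability by
a multiple of `(δ / t) ^ 4`, which leaves enough room for all rounds, epochs, lines and depths.

Lagrange interpolation reproduces the Taylor polynomial of `g*` exactly, so the interpolant of the
line-search outputs differs from `g*` only through the Taylor remainder and the errors `ε_l` at
the nodes, amplified at most by the Lebesgue constant: the total is at most `2 b`, and the
margin `4 b` makes the output sets correct with abstention half-width `6 b`.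

The noise condition `|η - 1/2| ≥ c |x_d - g*| ^ (κ - 1)` bounds the rounds spent in an epoch. If
`6 b` at the last completed depth exceeded `widthBound`, then the next depth would cost so little
that the budget would have sufficed to complete it too, a contradiction.

Dividing the confidence by `m` alone does not pay for the union bound over all
`(M_l + 1) ^ (d - 1)` lines at the depths with `2 ^ (l + 1) ≤ ⌈α⌉`. The good event therefore uses
a smaller confidence parameter at those depths, where the output is correct for the trivial
reason that the interpolant is bounded by the Lebesgue constant, hence by `b`.
-/

namespace ActiveLearning

/-! ### Lagrange interpolation at equispaced nodes -/

/-- The `j`-th Lagrange basis polynomial of the nodes `0, …, r`, evaluated at `u`: the univariate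
factor of `lagrangeBasis`, in units of the grid step. -/
noncomputable def natLagrange (r j : ℕ) (u : ℝ) : ℝ :=
  ∏ j' ∈ (Finset.range (r + 1)).erase j, (u - j') / ((j : ℝ) - j')

theorem natLagrange_eq_eval_basis (r j : ℕ) (u : ℝ) :
    natLagrange r j u
      = (Lagrange.basis (Finset.range (r + 1)) (fun i : ℕ => (i : ℝ)) j).eval u := by
  simp only [natLagrange, Lagrange.basis, Lagrange.basisDivisor, Polynomial.eval_prod,
    Polynomial.eval_mul, Polynomial.eval_C, Polynomial.eval_sub, Polynomial.eval_X, div_eq_inv_mul]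

theorem sum_natLagrange_mul_pow {r k : ℕ} (hk : k ≤ r) (u : ℝ) :
    ∑ j ∈ Finset.range (r + 1), natLagrange r j u * ((j : ℝ) - u) ^ k = 0 ^ k := by
  have hdeg : ((Polynomial.X - Polynomial.C u) ^ k : Polynomial ℝ).degree
      < (Finset.range (r + 1)).card := by
    simpa [Polynomial.degree_pow, Polynomial.degree_X_sub_C] using
      (by exact_mod_cast Nat.lt_succ_of_le hk : (k : WithBot ℕ) < r + 1)
  have h := congrArg (Polynomial.eval u)
    (Lagrange.eq_interpolate (Nat.cast_injective (R := ℝ)).injOn hdeg)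
  simp only [Lagrange.interpolate_apply, Polynomial.eval_finsetSum, Polynomial.eval_pow,
    Polynomial.eval_sub, Polynomial.eval_X, Polynomial.eval_C, sub_self, Polynomial.eval_mul] at h
  simp only [h, natLagrange_eq_eval_basis, mul_comm]

theorem prod_range_cast_sub (k : ℕ) : ∏ i ∈ Finset.range k, ((k : ℝ) - i) = k.factorial := by
  rw [← Finset.prod_range_reflect, ← Finset.prod_range_add_one_eq_factorial, Nat.cast_prod]
  refine Finset.prod_congr rfl fun i hi => ?_
  have : k - 1 - i + (i + 1) = k := by have := Finset.mem_range.1 hi; omega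
  linarith [(by exact_mod_cast this : ((k - 1 - i : ℕ) : ℝ) + ((i + 1 : ℕ) : ℝ) = k)]

theorem prod_erase_abs_cast_sub (j i : ℕ) :
    ∏ j' ∈ (Finset.range (j + 1 + i)).erase j, |(j : ℝ) - j'| = j.factorial * i.factorial := by
  induction i with
  | zero =>
    rw [add_zero, Finset.range_add_one, Finset.erase_insert Finset.notMem_range_self,
      ← prod_range_cast_sub, Nat.factorial_zero, Nat.cast_one, mul_one]
    refine Finset.prod_congr rfl fun j' hj' => abs_of_nonneg (sub_nonneg.2 ?_)
    exact_mod_cast (Finset.mem_range.1 hj').le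
  | succ i ih =>
    rw [← add_assoc, Finset.range_add_one, Finset.erase_insert_of_ne (by omega),
      Finset.prod_insert (by simp), ih, Nat.factorial_succ, abs_sub_comm]
    push_cast
    rw [add_assoc, add_sub_cancel_left, abs_of_nonneg (by positivity)]
    ring

theorem prod_erase_abs_sub_le {k : ℕ} {u : ℝ} (hk : k ≤ u) (hk' : u ≤ k + 1) (m j : ℕ) :
    ∏ j' ∈ (Finset.range (k + 1 + m)).erase j, |u - j'| ≤ (k + 1).factorial * m.factorial := by
  set b : ℕ → ℝ := fun j' => max ((k : ℝ) + 1 - j') (j' - k)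
  have hb : ∀ j' : ℕ, |u - j'| ≤ b j' := fun j' =>
    abs_le'.2 ⟨le_max_of_le_left (by linarith), le_max_of_le_right (by linarith)⟩
  have b_of_le : ∀ j' ∈ Finset.range (k + 1), b j' = ((k + 1 : ℕ) : ℝ) - j' := fun j' hj' => by
    have : (j' : ℝ) ≤ k := by exact_mod_cast Finset.mem_range_succ_iff.1 hj'
    simpa [b] using (by linarith : (j' : ℝ) - k ≤ k + 1 - j')
  have b_add : ∀ i : ℕ, b (k + 1 + i) = ((i + 1 : ℕ) : ℝ) := fun i => by
    have : (0 : ℝ) ≤ i := Nat.cast_nonneg i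
    simp only [b]
    push_cast
    rw [max_eq_right (by linarith)]
    ring
  have one_le_b : ∀ j', 1 ≤ b j' := fun j' => by
    rcases Nat.lt_or_ge j' (k + 1) with h | h
    · have : (j' : ℝ) ≤ k := by exact_mod_cast Nat.lt_succ_iff.1 h
      exact le_max_of_le_left (by linarith)
    · have : (k : ℝ) + 1 ≤ j' := by exact_mod_cast h
      exact le_max_of_le_right (by linarith)
  calc ∏ j' ∈ (Finset.range (k + 1 + m)).erase j, |u - j'|
      ≤ ∏ j' ∈ (Finset.range (k + 1 + m)).erase j, b j' := by gcongr with j' _; exact hb j'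
    _ ≤ ∏ j' ∈ Finset.range (k + 1 + m), b j' :=
      Finset.prod_le_prod_of_subset_of_one_le (Finset.erase_subset _ _)
        (fun j' _ => zero_le_one.trans (one_le_b j')) fun j' _ _ => one_le_b j'
    _ = (k + 1).factorial * m.factorial := by
      rw [Finset.prod_range_add, Finset.prod_congr rfl b_of_le, prod_range_cast_sub]
      simp only [b_add]
      rw [← Finset.prod_range_add_one_eq_factorial m, Nat.cast_prod]

theorem factorial_succ_mul_factorial_succ_le (k m : ℕ) :
    (k + 1).factorial * (m + 1).factorial ≤ (k + m + 1).factorial := by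
  induction m with
  | zero => simp
  | succ m ih =>
    calc (k + 1).factorial * (m + 1 + 1).factorial
        = (m + 2) * ((k + 1).factorial * (m + 1).factorial) := by
          rw [Nat.factorial_succ (m + 1)]; ring
      _ ≤ (k + m + 2) * (k + m + 1).factorial := Nat.mul_le_mul (by omega) ih
      _ = (k + (m + 1) + 1).factorial := (Nat.factorial_succ (k + m + 1)).symm

theorem prod_erase_abs_sub_le_factorial {r : ℕ} {u : ℝ} (hu : u ∈ Set.Icc (0 : ℝ) r) (j : ℕ) :
    ∏ j' ∈ (Finset.range (r + 1)).erase j, |u - j'| ≤ r.factorial := by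
  obtain ⟨h0, hr⟩ := hu
  rcases Nat.eq_zero_or_pos r with rfl | hpos
  · obtain rfl : u = 0 := le_antisymm (by simpa using hr) h0
    rcases j with _ | j <;> simp
  · obtain ⟨k, m, rfl, hk, hk'⟩ : ∃ k m : ℕ, r = k + m + 1 ∧ (k : ℝ) ≤ u ∧ u ≤ k + 1 := by
      rcases h0.eq_or_lt with rfl | h0
      · exact ⟨0, r - 1, by omega, by simp⟩
      · have hceil : 0 < ⌈u⌉₊ := Nat.ceil_pos.2 h0
        have hle : ⌈u⌉₊ ≤ r := Nat.ceil_le.2 hr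
        refine ⟨⌈u⌉₊ - 1, r - ⌈u⌉₊, by omega, ?_, ?_⟩
        · exact (Nat.lt_ceil.1 (Nat.sub_lt hceil one_pos)).le
        · exact_mod_cast (Nat.le_ceil u).trans_eq (by rw [Nat.sub_add_cancel hceil])
    calc _ ≤ ((k + 1).factorial : ℝ) * (m + 1).factorial := by
          have h := prod_erase_abs_sub_le hk hk' (m + 1) j
          rwa [show k + 1 + (m + 1) = k + m + 1 + 1 by ring] at h
      _ ≤ _ := by exact_mod_cast factorial_succ_mul_factorial_succ_le k m

theorem abs_natLagrange_le_choose {r j : ℕ} (hj : j ≤ r) {u : ℝ} (hu : u ∈ Set.Icc (0 : ℝ) r) :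
    |natLagrange r j u| ≤ r.choose j := by
  obtain ⟨i, rfl⟩ := Nat.exists_eq_add_of_le hj
  have hden := prod_erase_abs_cast_sub j i
  rw [add_right_comm] at hden
  simp only [natLagrange, Finset.abs_prod, abs_div]
  rw [Finset.prod_div_distrib, hden, div_le_iff₀ (by positivity)]
  calc _ ≤ ((j + i).factorial : ℝ) := prod_erase_abs_sub_le_factorial hu j
    _ = _ := by
      rw [← Nat.add_choose_mul_factorial_mul_factorial j i, ← Nat.choose_symm_add]
      push_cast
      ring

theorem sum_abs_natLagrange_le {r : ℕ} {u : ℝ} (hu : u ∈ Set.Icc (0 : ℝ) r) :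
    ∑ j ∈ Finset.range (r + 1), |natLagrange r j u| ≤ 2 ^ r :=
  calc _ ≤ ∑ j ∈ Finset.range (r + 1), (r.choose j : ℝ) :=
        Finset.sum_le_sum fun _ hj => abs_natLagrange_le_choose (Finset.mem_range_succ_iff.1 hj) hu
    _ = 2 ^ r := by exact_mod_cast Nat.sum_range_choose r

/-! ### Tensor products of exact linear functionals -/

section Tensor

variable {ι : Type*} [Fintype ι] [DecidableEq ι] {k : ℕ}

theorem multilinear_diag_eq_sum (D : MultilinearMap ℝ (fun _ : Fin k => ι → ℝ) ℝ) (v : ι → ℝ) :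
    D (fun _ => v) = ∑ f : Fin k → ι,
      (∏ i, v i ^ (Finset.univ.filter fun s => f s = i).card) *
        D fun s => Pi.single (f s) 1 := by
  have hv : v = ∑ i, v i • (Pi.single i 1 : ι → ℝ) := pi_eq_sum_univ' v
  conv_lhs => rw [hv]
  rw [MultilinearMap.map_sum]
  refine Finset.sum_congr rfl fun f _ => ?_
  rw [D.map_smul_univ (fun s => v (f s)) fun s => Pi.single (f s) 1, smul_eq_mul,
    ← Finset.prod_fiberwise' Finset.univ f v]
  simp only [Finset.prod_const]

/-- If, in each coordinate, the weights `w i` at the points `p i` have the moments `0 ^ e` of the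
point mass at `0` up to order `r`, then their tensor product integrates diagonal forms of degree at
most `r` like the point mass at `0`. -/
theorem sum_tensor_mul_multilinear_diag {r : ℕ} {s : Finset ℕ} {w p : ι → ℕ → ℝ}
    (hw : ∀ i, ∀ e ≤ r, ∑ j ∈ s, w i j * p i j ^ e = 0 ^ e) (hk : k ≤ r)
    (D : MultilinearMap ℝ (fun _ : Fin k => ι → ℝ) ℝ) :
    ∑ j ∈ Fintype.piFinset fun _ : ι => s, (∏ i, w i (j i)) * D (fun _ i => p i (j i))
      = D fun _ => 0 := by
  rw [multilinear_diag_eq_sum D 0]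
  simp only [multilinear_diag_eq_sum D fun i => p i _, Finset.mul_sum]
  rw [Finset.sum_comm]
  refine Finset.sum_congr rfl fun f _ => ?_
  simp only [← mul_assoc, ← Finset.prod_mul_distrib]
  rw [← Finset.sum_mul, ← Finset.prod_univ_sum (fun _ : ι => s)
    fun i j => w i j * p i j ^ (Finset.univ.filter fun s => f s = i).card]
  congr 1
  refine Finset.prod_congr rfl fun i _ => hw i _ ?_
  exact ((Finset.card_filter_le _ _).trans (by simp)).trans hk

end Tensor

/-! ### The grid -/

section Grid

variable {d : ℕ} (α : ℝ) (l : ℕ)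

theorem one_le_cellNodes : 1 ≤ cellNodes α := le_max_left _ _

theorem strictFloor_le_cellNodes : strictFloor α ≤ cellNodes α := le_max_right _ _

theorem gridSize_pos : 0 < gridSize α l := Nat.mul_pos (one_le_cellNodes α) (by positivity)

theorem gridPoint_mem_baseCube {a : Fin (d - 1) → ℕ} (ha : a ∈ lineIndices d α l) :
    gridPoint α l a ∈ baseCube d := by
  have hM : (0 : ℝ) < gridSize α l := by exact_mod_cast gridSize_pos α l
  rw [lineIndices, Fintype.mem_piFinset] at ha
  refine ⟨fun i => div_nonneg (Nat.cast_nonneg _) hM.le, fun i => (div_le_one hM).2 ?_⟩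
  exact_mod_cast Finset.mem_range_succ_iff.1 (ha i)

theorem cellIndex_add_one_le (x : Fin (d - 1) → ℝ) (i : Fin (d - 1)) :
    cellIndex l x i + 1 ≤ 2 ^ l := by
  have hpos : 0 < 2 ^ l := by positivity
  have h : cellIndex l x i ≤ 2 ^ l - 1 := min_le_right _ _
  omega

theorem mul_two_pow_mem_Icc_cellIndex {x : Fin (d - 1) → ℝ} (hx : x ∈ baseCube d)
    (i : Fin (d - 1)) :
    x i * 2 ^ l ∈ Set.Icc (cellIndex l x i : ℝ) (cellIndex l x i + 1) := by
  have h0 : 0 ≤ x i * 2 ^ l := mul_nonneg (hx.1 i) (by positivity)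
  refine ⟨(Nat.cast_le.2 (min_le_left _ _)).trans (Nat.floor_le h0), ?_⟩
  rcases min_choice ⌊x i * 2 ^ l⌋₊ (2 ^ l - 1) with h | h
  · rw [cellIndex, h]
    exact (Nat.lt_floor_add_one _).le
  · rw [cellIndex, h, Nat.cast_sub Nat.one_le_two_pow]
    push_cast
    rw [sub_add_cancel]
    exact mul_le_of_le_one_left (by positivity) (hx.2 i)

/-- Offsets `{0, …, ⌊α⌋}^(d-1)` of the interpolation nodes of a cell from its lower corner. -/
noncomputable abbrev nodeOffsets (d : ℕ) (α : ℝ) : Finset (Fin (d - 1) → ℕ) :=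
  Fintype.piFinset fun _ => Finset.range (strictFloor α + 1)

/-- Index, in the grid of depth `l`, of the node with offset `j` in the cell containing `x`. -/
noncomputable def nodeIndex (x : Fin (d - 1) → ℝ) (j : Fin (d - 1) → ℕ) : Fin (d - 1) → ℕ :=
  fun i => cellNodes α * cellIndex l x i + j i

/-- Coordinates of `x` relative to the lower corner of its cell, in units of the grid step. -/
noncomputable def cellCoord (x : Fin (d - 1) → ℝ) : Fin (d - 1) → ℝ :=
  fun i => x i * gridSize α l - cellNodes α * cellIndex l x i

theorem offset_le {j : Fin (d - 1) → ℕ} (hj : j ∈ nodeOffsets d α) (i : Fin (d - 1)) :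
    j i ≤ strictFloor α :=
  Finset.mem_range_succ_iff.1 (Fintype.mem_piFinset.1 hj i)

theorem nodeIndex_mem_lineIndices (x : Fin (d - 1) → ℝ) {j : Fin (d - 1) → ℕ}
    (hj : j ∈ nodeOffsets d α) : nodeIndex α l x j ∈ lineIndices d α l := by
  refine Fintype.mem_piFinset.2 fun i => Finset.mem_range_succ_iff.2 ?_
  calc cellNodes α * cellIndex l x i + j i
      ≤ cellNodes α * cellIndex l x i + cellNodes α :=
        Nat.add_le_add_left ((offset_le α hj i).trans (strictFloor_le_cellNodes α)) _
    _ = cellNodes α * (cellIndex l x i + 1) := by ring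
    _ ≤ gridSize α l := Nat.mul_le_mul_left _ (cellIndex_add_one_le l x i)

theorem cellCoord_mem_Icc {x : Fin (d - 1) → ℝ} (hx : x ∈ baseCube d) (i : Fin (d - 1)) :
    cellCoord α l x i ∈ Set.Icc (0 : ℝ) (cellNodes α) := by
  obtain ⟨h1, h2⟩ := mul_two_pow_mem_Icc_cellIndex l hx i
  have hm : (0 : ℝ) ≤ cellNodes α := Nat.cast_nonneg _
  have e : cellCoord α l x i = cellNodes α * (x i * 2 ^ l - cellIndex l x i) := by
    simp only [cellCoord, gridSize]
    push_cast
    ring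
  rw [e]
  exact ⟨mul_nonneg hm (by linarith), mul_le_of_le_one_right hm (by linarith)⟩

theorem gridPoint_nodeIndex_sub (x : Fin (d - 1) → ℝ) (j : Fin (d - 1) → ℕ) :
    gridPoint α l (nodeIndex α l x j) - x = fun i => (j i - cellCoord α l x i) / gridSize α l := by
  have hM : (gridSize α l : ℝ) ≠ 0 := by exact_mod_cast (gridSize_pos α l).ne'
  ext i
  simp only [Pi.sub_apply, gridPoint, nodeIndex, cellCoord]
  push_cast
  field_simp
  ring

theorem norm_gridPoint_nodeIndex_sub_le {x : Fin (d - 1) → ℝ} (hx : x ∈ baseCube d)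
    {j : Fin (d - 1) → ℕ} (hj : j ∈ nodeOffsets d α) :
    ‖gridPoint α l (nodeIndex α l x j) - x‖ ≤ ((2 : ℝ) ^ l)⁻¹ := by
  rw [pi_norm_le_iff_of_nonneg (by positivity)]
  intro i
  have hm : (0 : ℝ) < cellNodes α := by exact_mod_cast one_le_cellNodes α
  have : (0 : ℝ) ≤ j i := Nat.cast_nonneg _
  have hjm : (j i : ℝ) ≤ cellNodes α := by
    exact_mod_cast (offset_le α hj i).trans (strictFloor_le_cellNodes α)
  obtain ⟨h0, h1⟩ := cellCoord_mem_Icc α l hx i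
  have hdist : |(j i : ℝ) - cellCoord α l x i| ≤ cellNodes α :=
    abs_le.2 ⟨by linarith, by linarith⟩
  rw [gridPoint_nodeIndex_sub, Real.norm_eq_abs, abs_div, Nat.abs_cast, gridSize, Nat.cast_mul,
    Nat.cast_pow, Nat.cast_ofNat]
  calc |(j i : ℝ) - cellCoord α l x i| / (cellNodes α * 2 ^ l)
      ≤ cellNodes α / (cellNodes α * 2 ^ l) := by gcongr
    _ = ((2 : ℝ) ^ l)⁻¹ := by field_simp

/-! ### The piecewise interpolant -/

theorem lagrangeBasis_eq_prod_natLagrange (x : Fin (d - 1) → ℝ) (j : Fin (d - 1) → ℕ) :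
    lagrangeBasis α l (cellIndex l x) j x
      = ∏ i, natLagrange (strictFloor α) (j i) (cellCoord α l x i) := by
  have hM : (gridSize α l : ℝ) ≠ 0 := by exact_mod_cast (gridSize_pos α l).ne'
  unfold lagrangeBasis natLagrange cellCoord
  refine Finset.prod_congr rfl fun i _ => Finset.prod_congr rfl fun j' _ => ?_
  rw [← mul_div_mul_right _ (_ - _) hM]
  congr 1 <;> push_cast <;> field_simp <;> ring

theorem sum_abs_lagrangeBasis_le {x : Fin (d - 1) → ℝ} (hx : x ∈ baseCube d) :
    ∑ j ∈ nodeOffsets d α, |lagrangeBasis α l (cellIndex l x) j x|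
      ≤ (2 : ℝ) ^ (strictFloor α * (d - 1)) := by
  have hone : ∀ i, ∑ j ∈ Finset.range (strictFloor α + 1),
      |natLagrange (strictFloor α) j (cellCoord α l x i)| ≤ 2 ^ strictFloor α := fun i => by
    rcases Nat.eq_zero_or_pos (strictFloor α) with h0 | hpos
    · simp [h0, natLagrange]
    · have h := cellCoord_mem_Icc α l hx i
      rw [cellNodes, max_eq_right hpos] at h
      exact sum_abs_natLagrange_le h
  simp only [lagrangeBasis_eq_prod_natLagrange, Finset.abs_prod]
  rw [← Finset.prod_univ_sum (fun _ : Fin (d - 1) => Finset.range (strictFloor α + 1))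
    fun i j => |natLagrange (strictFloor α) j (cellCoord α l x i)|]
  calc _ ≤ ∏ _i : Fin (d - 1), (2 : ℝ) ^ strictFloor α :=
        Finset.prod_le_prod (fun _ _ => Finset.sum_nonneg fun _ _ => abs_nonneg _) fun i _ => hone i
    _ = _ := by simp [← pow_mul]

/-- Interpolation is exact on polynomials of total degree at most `⌊α⌋`, in particular on the
Taylor polynomial centred at the evaluation point. -/
theorem sum_lagrangeBasis_mul_taylorPoly (g : (Fin (d - 1) → ℝ) → ℝ) (x : Fin (d - 1) → ℝ) :
    ∑ j ∈ nodeOffsets d α, lagrangeBasis α l (cellIndex l x) j x *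
        taylorPoly g (strictFloor α) x (gridPoint α l (nodeIndex α l x j)) = g x := by
  have moments : ∀ i, ∀ e ≤ strictFloor α, ∑ j ∈ Finset.range (strictFloor α + 1),
      natLagrange (strictFloor α) j (cellCoord α l x i) *
        ((j - cellCoord α l x i) / gridSize α l) ^ e = 0 ^ e := fun i e he => by
    simp only [div_pow, mul_div_assoc']
    rw [← Finset.sum_div, sum_natLagrange_mul_pow he]
    rcases e.eq_zero_or_pos with rfl | hpos
    · simp
    · simp [zero_pow hpos.ne']
  have taylor_self : taylorPoly g (strictFloor α) x x = g x := by
    rw [taylorPoly, Finset.sum_range_succ', Finset.sum_eq_zero]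
    · simp [iteratedFDerivWithin_zero_apply]
    · intro k _
      rw [sub_self, ContinuousMultilinearMap.map_coord_zero _ 0 rfl, mul_zero]
  simp only [lagrangeBasis_eq_prod_natLagrange]
  rw [← taylor_self]
  simp only [taylorPoly, Finset.mul_sum]
  rw [Finset.sum_comm]
  refine Finset.sum_congr rfl fun k hk => ?_
  have h := sum_tensor_mul_multilinear_diag moments (Finset.mem_range_succ_iff.1 hk)
    (iteratedFDerivWithin ℝ k g (baseCube d) x).toMultilinearMap
  simp only [mul_left_comm _ (1 / (k.factorial : ℝ)), ← Finset.mul_sum, gridPoint_nodeIndex_sub,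
    sub_self]
  exact congrArg _ h

theorem interpolant_eq_sum (T : (Fin (d - 1) → ℕ) → ℝ) (x : Fin (d - 1) → ℝ) :
    interpolant α l T x
      = ∑ j ∈ nodeOffsets d α, lagrangeBasis α l (cellIndex l x) j x * T (nodeIndex α l x j) :=
  Finset.sum_congr rfl fun _ _ => mul_comm _ _

theorem abs_sum_lagrangeBasis_mul_le {v : (Fin (d - 1) → ℕ) → ℝ} {C : ℝ}
    (hv : ∀ j ∈ nodeOffsets d α, |v j| ≤ C) {x : Fin (d - 1) → ℝ} (hx : x ∈ baseCube d) :
    |∑ j ∈ nodeOffsets d α, lagrangeBasis α l (cellIndex l x) j x * v j|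
      ≤ (2 : ℝ) ^ (strictFloor α * (d - 1)) * C := by
  have hC : 0 ≤ C := (abs_nonneg _).trans (hv 0 (by simp [Fintype.mem_piFinset]))
  calc _ ≤ ∑ j ∈ nodeOffsets d α, |lagrangeBasis α l (cellIndex l x) j x| * C := by
        refine (Finset.abs_sum_le_sum_abs _ _).trans (Finset.sum_le_sum fun j hj => ?_)
        rw [abs_mul]
        exact mul_le_mul_of_nonneg_left (hv j hj) (abs_nonneg _)
    _ ≤ _ := by
        rw [← Finset.sum_mul]
        exact mul_le_mul_of_nonneg_right (sum_abs_lagrangeBasis_le α l hx) hC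

theorem abs_interpolant_le {T : (Fin (d - 1) → ℕ) → ℝ} {C : ℝ}
    (hT : ∀ a ∈ lineIndices d α l, |T a| ≤ C) {x : Fin (d - 1) → ℝ} (hx : x ∈ baseCube d) :
    |interpolant α l T x| ≤ (2 : ℝ) ^ (strictFloor α * (d - 1)) * C := by
  rw [interpolant_eq_sum]
  exact abs_sum_lagrangeBasis_mul_le α l
    (fun j hj => hT _ (nodeIndex_mem_lineIndices α l x hj)) hx

variable {α} in
theorem abs_interpolant_sub_le {lam ε : ℝ} (hlam : 0 ≤ lam) (hα : 0 < α)
    {g : (Fin (d - 1) → ℝ) → ℝ} (hg : HolderClass d lam α g) {T : (Fin (d - 1) → ℕ) → ℝ}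
    (hT : ∀ a ∈ lineIndices d α l, |T a - g (gridPoint α l a)| ≤ ε)
    {x : Fin (d - 1) → ℝ} (hx : x ∈ baseCube d) :
    |interpolant α l T x - g x|
      ≤ (2 : ℝ) ^ (strictFloor α * (d - 1)) * (ε + lam * (((2 : ℝ) ^ l)⁻¹) ^ α) := by
  conv_lhs => rw [← sum_lagrangeBasis_mul_taylorPoly α l g x]
  rw [interpolant_eq_sum, ← Finset.sum_sub_distrib]
  simp only [← mul_sub]
  refine abs_sum_lagrangeBasis_mul_le α l (fun j hj => ?_) hx
  have hnode := nodeIndex_mem_lineIndices α l x hj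
  have taylor_error := calc
    |g (gridPoint α l (nodeIndex α l x j)) -
        taylorPoly g (strictFloor α) x (gridPoint α l (nodeIndex α l x j))|
      ≤ lam * ‖gridPoint α l (nodeIndex α l x j) - x‖ ^ α :=
        hg.taylor α hα le_rfl _ (gridPoint_mem_baseCube α l hnode) x hx
    _ ≤ lam * (((2 : ℝ) ^ l)⁻¹) ^ α := by
        gcongr
        exact norm_gridPoint_nodeIndex_sub_le α l hx hj
  exact (abs_sub_le _ _ _).trans (add_le_add (hT _ hnode) taylor_error)

theorem measurable_cellIndex :
    Measurable (cellIndex l : (Fin (d - 1) → ℝ) → (Fin (d - 1) → ℕ)) :=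
  measurable_pi_lambda _ fun i =>
    (Nat.measurable_floor.comp ((measurable_pi_apply i).mul_const _)).min measurable_const

theorem measurable_interpolant (T : (Fin (d - 1) → ℕ) → ℝ) :
    Measurable (interpolant α l T : (Fin (d - 1) → ℝ) → ℝ) := by
  have hcell : ∀ f : (Fin (d - 1) → ℕ) → ℝ,
      Measurable fun x : Fin (d - 1) → ℝ => f (cellIndex l x) :=
    fun f => (measurable_of_countable f).comp (measurable_cellIndex l)
  refine Finset.measurable_sum _ fun j _ =>
    (hcell fun q => T fun i => cellNodes α * q i + j i).mul ?_
  refine Finset.measurable_prod _ fun i _ => Finset.measurable_prod _ fun j' _ => ?_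
  refine ((measurable_pi_apply i).sub ?_).div ?_
  · exact hcell fun q => ((cellNodes α * q i + j' : ℕ) : ℝ) / gridSize α l
  · exact hcell fun q => ((cellNodes α * q i + j i : ℕ) : ℝ) / gridSize α l -
      ((cellNodes α * q i + j' : ℕ) : ℝ) / gridSize α l

end Grid

/-! ### One epoch of the line search -/

section Epoch

/-- The points `U, M, V` (for `j = 0, 1, 2`) queried in an epoch on the interval `[I.1, I.2]`. -/
noncomputable def quartile (j : Fin 3) (I : ℝ × ℝ) : ℝ :=
  ![(I.2 - I.1) / 4 + I.1, (I.1 + I.2) / 2, (I.2 - I.1) / 4 + (I.1 + I.2) / 2] j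

theorem quartile_zero_eq (I : ℝ × ℝ) : quartile 0 I = quartile 1 I - (I.2 - I.1) / 4 := by
  simp only [quartile, Matrix.cons_val]
  ring

theorem quartile_two_eq (I : ℝ × ℝ) : quartile 2 I = quartile 1 I + (I.2 - I.1) / 4 := by
  simp only [quartile, Matrix.cons_val]
  ring

theorem quartile_mem_Icc {I : ℝ × ℝ} (hI : I.1 ≤ I.2) (j : Fin 3) :
    quartile j I ∈ Set.Icc I.1 I.2 := by
  fin_cases j <;> simp only [quartile, Fin.reduceFinMk, Matrix.cons_val] <;> constructor <;>
    linarith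

/-- Empirical mean of the first `t` labels at the `j`-th quartile of `I`. -/
noncomputable def quartileMean (y : Fin 3 → ℕ → ℝ → Bool) (I : ℝ × ℝ) (j : Fin 3) (t : ℕ) : ℝ :=
  empMean (fun i => y j i (quartile j I)) t

/-- The labels of the first `t` rounds of an epoch on `I` allow it to stop and to continue with
the given interval. This relation forgets both that the epoch stops at the first such round and
that the outer points matter only when the middle one is undecided. -/
inductive EpochStep (y : Fin 3 → ℕ → ℝ → Bool) (δ : ℝ) (I : ℝ × ℝ) (t : ℕ) : ℝ × ℝ → Prop
  | left (hM : conf δ t ≤ quartileMean y I 1 t - 1 / 2) : EpochStep y δ I t (I.1, quartile 1 I)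
  | right (hM : conf δ t ≤ 1 / 2 - quartileMean y I 1 t) : EpochStep y δ I t (quartile 1 I, I.2)
  | center (hU : conf δ t ≤ 1 / 2 - quartileMean y I 0 t)
      (hV : conf δ t ≤ quartileMean y I 2 t - 1 / 2) :
      EpochStep y δ I t (quartile 0 I, quartile 2 I)

/-- `θ` separates the points of `[0,1]` with `η < 1/2` from those with `1/2 ≤ η`. -/
def IsThreshold (η : ℝ → ℝ) (θ : ℝ) : Prop :=
  ∀ z ∈ Set.Icc (0 : ℝ) 1, 1 / 2 ≤ η z ↔ θ ≤ z

variable {y : Fin 3 → ℕ → ℝ → Bool} {δ θ : ℝ} {η : ℝ → ℝ} {I J : ℝ × ℝ} {B t : ℕ}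

theorem EpochStep.decided (h : EpochStep y δ I t J) :
    MidDecided (fun i => y 1 i (quartile 1 I)) δ t ∨
      OuterDecided (fun i => y 0 i (quartile 0 I)) (fun i => y 2 i (quartile 2 I)) δ t := by
  cases h with
  | left hM => exact Or.inl (hM.trans (le_abs_self _))
  | right hM => exact Or.inl (hM.trans ((le_abs_self _).trans_eq (abs_sub_comm _ _)))
  | center hU hV => exact Or.inr ⟨hV, hU⟩

theorem epochRun_spec (y : Fin 3 → ℕ → ℝ → Bool) (δ : ℝ) (I : ℝ × ℝ) (B : ℕ) :
    (∃ t J, 1 ≤ t ∧ 3 * t ≤ B ∧ EpochStep y δ I t J ∧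
        (∀ s J', 1 ≤ s → 3 * s ≤ B → EpochStep y δ I s J' → t ≤ s) ∧
        epochRun y δ I B = (3 * t, some J)) ∨
      ((∀ s J', 1 ≤ s → 3 * s ≤ B → ¬ EpochStep y δ I s J') ∧
        epochRun y δ I B = (3 * (B / 3), none)) := by
  classical
  unfold epochRun
  dsimp only
  by_cases hex : ∃ t, 1 ≤ t ∧ 3 * t ≤ B ∧ (MidDecided (fun i => y 1 i ((I.1 + I.2) / 2)) δ t ∨
      OuterDecided (fun i => y 0 i ((I.2 - I.1) / 4 + I.1))
        (fun i => y 2 i ((I.2 - I.1) / 4 + (I.1 + I.2) / 2)) δ t)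
  · obtain ⟨hpos, hB, hdec⟩ := Nat.find_spec hex
    rw [dif_pos hex]
    refine Or.inl ⟨Nat.find hex, _, hpos, hB, ?_,
      fun s J' hs hsB hstep => Nat.find_min' hex ⟨hs, hsB, hstep.decided⟩, rfl⟩
    split_ifs with hmid hhalf
    · rw [MidDecided, abs_of_pos (sub_pos.2 hhalf)] at hmid
      exact .left hmid
    · rw [MidDecided, abs_of_nonpos (sub_nonpos.2 (not_lt.1 hhalf)), neg_sub] at hmid
      exact .right hmid
    · obtain ⟨hV, hU⟩ := hdec.resolve_left hmid
      exact .center hU hV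
  · rw [dif_neg hex]
    exact Or.inr ⟨fun s J' hs hsB hstep => hex ⟨s, hs, hsB, hstep.decided⟩, rfl⟩

theorem epochRun_fst_le (y : Fin 3 → ℕ → ℝ → Bool) (δ : ℝ) (I : ℝ × ℝ) (B : ℕ) :
    (epochRun y δ I B).1 ≤ B := by
  obtain ⟨t, J, -, hB, -, -, hrun⟩ | ⟨-, hrun⟩ := epochRun_spec y δ I B <;> rw [hrun]
  · exact hB
  · exact Nat.mul_div_le B 3

theorem epochStep_of_epochRun_eq_some (h : (epochRun y δ I B).2 = some J) :
    ∃ t, 1 ≤ t ∧ (epochRun y δ I B).1 = 3 * t ∧ EpochStep y δ I t J := by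
  obtain ⟨t, J', ht, -, hstep, -, hrun⟩ | ⟨-, hrun⟩ := epochRun_spec y δ I B <;> rw [hrun] at h ⊢
  · obtain rfl : J' = J := Option.some.inj h
    exact ⟨t, ht, rfl, hstep⟩
  · cases h

theorem EpochStep.epochRun_terminates (h : EpochStep y δ I t J) (ht : 1 ≤ t) (hB : 3 * t ≤ B) :
    ∃ J', (epochRun y δ I B).2 = some J' ∧ (epochRun y δ I B).1 ≤ 3 * t := by
  obtain ⟨s, J', -, -, -, hmin, hrun⟩ | ⟨hnone, -⟩ := epochRun_spec y δ I B
  · rw [hrun]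
    exact ⟨J', rfl, Nat.mul_le_mul_left 3 (hmin t J ht hB h)⟩
  · exact absurd h (hnone t J ht hB)

theorem EpochStep.mem_Icc (h : EpochStep y δ I t J) (hη : IsThreshold η θ)
    (hquart : ∀ j, quartile j I ∈ Set.Icc (0 : ℝ) 1)
    (hdev : ∀ j, |quartileMean y I j t - η (quartile j I)| < conf δ t)
    (hθ : θ ∈ Set.Icc I.1 I.2) : θ ∈ Set.Icc J.1 J.2 := by
  have le_of_decided_one : ∀ j, conf δ t ≤ quartileMean y I j t - 1 / 2 → θ ≤ quartile j I :=
    fun j hj => (hη _ (hquart j)).1 (by linarith [(abs_lt.1 (hdev j)).2])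
  have le_of_decided_zero : ∀ j, conf δ t ≤ 1 / 2 - quartileMean y I j t → quartile j I ≤ θ := by
    intro j hj
    by_contra! hlt
    linarith [(abs_lt.1 (hdev j)).1, (hη _ (hquart j)).2 hlt.le]
  cases h with
  | left hM => exact ⟨hθ.1, le_of_decided_one 1 hM⟩
  | right hM => exact ⟨le_of_decided_zero 1 hM, hθ.2⟩
  | center hU hV => exact ⟨le_of_decided_zero 0 hU, le_of_decided_one 2 hV⟩

/-- If `M` is far from the threshold it gets decided, and otherwise both `U` and `V` are far from
the threshold. The threshold itself may lie outside `I`. -/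
theorem exists_epochStep {gap w : ℝ} (hη : IsThreshold η θ) (hI : I.1 < I.2)
    (hquart : ∀ j, quartile j I ∈ Set.Icc (0 : ℝ) 1)
    (hgap : ∀ z ∈ Set.Icc (0 : ℝ) 1, (I.2 - I.1) / 8 ≤ |z - θ| → gap ≤ |η z - 1 / 2|)
    (hw : conf δ t ≤ w) (hwgap : 2 * w ≤ gap)
    (hdev : ∀ j, |quartileMean y I j t - η (quartile j I)| < w) :
    ∃ J, EpochStep y δ I t J := by
  have decided_one : ∀ j, θ + (I.2 - I.1) / 8 ≤ quartile j I →
      conf δ t ≤ quartileMean y I j t - 1 / 2 := by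
    intro j hj
    have h := hgap _ (hquart j) (by rw [abs_of_nonneg] <;> linarith)
    rw [abs_of_nonneg (by linarith [(hη _ (hquart j)).2 (by linarith)])] at h
    linarith [(abs_lt.1 (hdev j)).1]
  have decided_zero : ∀ j, quartile j I ≤ θ - (I.2 - I.1) / 8 →
      conf δ t ≤ 1 / 2 - quartileMean y I j t := by
    intro j hj
    have h := hgap _ (hquart j) (by rw [abs_of_nonpos] <;> linarith)
    have hlt : η (quartile j I) < 1 / 2 := by
      by_contra! hle
      linarith [(hη _ (hquart j)).1 hle]
    rw [abs_of_neg (by linarith)] at h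
    linarith [(abs_lt.1 (hdev j)).2]
  rcases le_total (θ + (I.2 - I.1) / 8) (quartile 1 I) with hright | hright
  · exact ⟨_, .left (decided_one 1 hright)⟩
  rcases le_total (quartile 1 I) (θ - (I.2 - I.1) / 8) with hleft | hleft
  · exact ⟨_, .right (decided_zero 1 hleft)⟩
  · refine ⟨_, .center (decided_zero 0 ?_) (decided_one 2 ?_)⟩
    · linarith [quartile_zero_eq I]
    · linarith [quartile_two_eq I]

end Epoch

/-! ### The intervals a line search may visit -/

section Reachable

open Classical in
/-- The intervals that can occur after `k` epochs. -/
noncomputable def reachable : ℕ → Finset (ℝ × ℝ)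
  | 0 => {(0, 1)}
  | k + 1 => (reachable k).biUnion fun I =>
      {(I.1, quartile 1 I), (quartile 1 I, I.2), (quartile 0 I, quartile 2 I)}

variable {k : ℕ} {I J : ℝ × ℝ}

theorem card_reachable_le (k : ℕ) : (reachable k).card ≤ 3 ^ k := by
  classical
  induction k with
  | zero => simp [reachable]
  | succ k ih =>
    rw [reachable, pow_succ]
    exact (Finset.card_biUnion_le_card_mul _ _ 3 fun _ _ => Finset.card_le_three).trans
      (Nat.mul_le_mul_right _ ih)

theorem mem_reachable (hI : I ∈ reachable k) :
    0 ≤ I.1 ∧ I.2 ≤ 1 ∧ I.2 - I.1 = ((2 : ℝ) ^ k)⁻¹ := by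
  classical
  induction k generalizing I with
  | zero =>
    rw [reachable, Finset.mem_singleton] at hI
    subst hI
    norm_num
  | succ k ih =>
    simp only [reachable, Finset.mem_biUnion, Finset.mem_insert, Finset.mem_singleton] at hI
    obtain ⟨J, hJ, hI⟩ := hI
    obtain ⟨h0, h1, hlen⟩ := ih hJ
    have hpos : (0 : ℝ) < ((2 : ℝ) ^ k)⁻¹ := by positivity
    rw [pow_succ, mul_inv]
    rcases hI with rfl | rfl | rfl <;> simp only [quartile, Matrix.cons_val] <;>
      refine ⟨?_, ?_, ?_⟩ <;> linarith

theorem lt_of_mem_reachable (hI : I ∈ reachable k) : I.1 < I.2 := by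
  have hpos : (0 : ℝ) < ((2 : ℝ) ^ k)⁻¹ := by positivity
  linarith [(mem_reachable hI).2.2]

theorem quartile_mem_of_mem_reachable (hI : I ∈ reachable k) (j : Fin 3) :
    quartile j I ∈ Set.Icc (0 : ℝ) 1 :=
  Set.Icc_subset_Icc (mem_reachable hI).1 (mem_reachable hI).2.1
    (quartile_mem_Icc (lt_of_mem_reachable hI).le j)

theorem EpochStep.mem_reachable {y : Fin 3 → ℕ → ℝ → Bool} {δ : ℝ} {t : ℕ}
    (h : EpochStep y δ I t J) (hI : I ∈ reachable k) : J ∈ reachable (k + 1) := by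
  classical
  rw [reachable, Finset.mem_biUnion]
  exact ⟨I, hI, by cases h <;> simp⟩

end Reachable

/-! ### The line search -/

section LineSearch

theorem conf_le_conf {δ δ' : ℝ} (hδ' : 0 < δ') (h : δ' ≤ δ) {t : ℕ} (ht : 1 ≤ t) :
    conf δ t ≤ conf δ' t := by
  have : (0 : ℝ) < t := by exact_mod_cast ht
  have hδ : 0 < δ := hδ'.trans_le h
  unfold conf
  gcongr

variable {y : ℕ → Fin 3 → ℕ → ℝ → Bool} {δ δ' θ ε T : ℝ} {η : ℝ → ℝ} {K B k : ℕ} {I J : ℝ × ℝ}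

theorem epochs_succ_of_some (h : (epochs y δ K B k).2 = some I) :
    epochs y δ K B (k + 1) =
      ((epochs y δ K B k).1 +
        (epochRun (y (k + 1)) (δ / (K * 2 ^ (k + 1))) I (B - (epochs y δ K B k).1)).1,
        (epochRun (y (k + 1)) (δ / (K * 2 ^ (k + 1))) I (B - (epochs y δ K B k).1)).2) := by
  rw [epochs]
  rcases hE : epochs y δ K B k with ⟨N, _ | J⟩ <;> rw [hE] at h
  · cases h
  · obtain rfl : J = I := Option.some.inj h
    rfl

theorem epochs_succ_of_none (h : (epochs y δ K B k).2 = none) :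
    epochs y δ K B (k + 1) = epochs y δ K B k := by
  rw [epochs]
  rcases hE : epochs y δ K B k with ⟨N, _ | J⟩
  · rfl
  · cases (congrArg Prod.snd hE).symm.trans h

theorem epochs_fst_le (y : ℕ → Fin 3 → ℕ → ℝ → Bool) (δ : ℝ) (K B k : ℕ) :
    (epochs y δ K B k).1 ≤ B := by
  induction k with
  | zero => exact Nat.zero_le B
  | succ k ih =>
    rcases hE : (epochs y δ K B k).2 with _ | I
    · rwa [epochs_succ_of_none hE]
    · rw [epochs_succ_of_some hE]
      exact Nat.add_le_of_le_sub' ih (epochRun_fst_le _ _ _ _)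

theorem epochStep_of_epochs_succ_eq_some (h : (epochs y δ K B (k + 1)).2 = some J) :
    ∃ I, (epochs y δ K B k).2 = some I ∧ ∃ t, 1 ≤ t ∧
      (epochs y δ K B (k + 1)).1 = (epochs y δ K B k).1 + 3 * t ∧
      EpochStep (y (k + 1)) (δ / (K * 2 ^ (k + 1))) I t J := by
  rcases hE : (epochs y δ K B k).2 with _ | I
  · rw [epochs_succ_of_none hE, hE] at h
    cases h
  · rw [epochs_succ_of_some hE] at h ⊢
    obtain ⟨t, ht, hcost, hstep⟩ := epochStep_of_epochRun_eq_some h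
    exact ⟨I, rfl, t, ht, by rw [hcost], hstep⟩

theorem mem_reachable_of_epochs_eq_some (h : (epochs y δ K B k).2 = some I) :
    I ∈ reachable k := by
  induction k generalizing I with
  | zero =>
    obtain rfl : (0, 1) = I := Option.some.inj h
    exact Finset.mem_singleton_self _
  | succ k ih =>
    obtain ⟨J, hJ, t, -, -, hstep⟩ := epochStep_of_epochs_succ_eq_some h
    exact hstep.mem_reachable (ih hJ)

/-- The good event of a line search: all empirical means at points that the search may visit are
within the confidence term of the regression function. -/
def LineDeviation (y : ℕ → Fin 3 → ℕ → ℝ → Bool) (η : ℝ → ℝ) (δ : ℝ) (K : ℕ) : Prop :=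
  ∀ k < K, ∀ I ∈ reachable k, ∀ j t, 1 ≤ t →
    |quartileMean (y (k + 1)) I j t - η (quartile j I)| < conf (δ / (K * 2 ^ (k + 1))) t

theorem mem_Icc_of_epochs_eq_some (hη : IsThreshold η θ) (hdev : LineDeviation y η δ K)
    (hθ : θ ∈ Set.Icc (0 : ℝ) 1) (hk : k ≤ K) (h : (epochs y δ K B k).2 = some I) :
    θ ∈ Set.Icc I.1 I.2 := by
  induction k generalizing I with
  | zero =>
    obtain rfl : (0, 1) = I := Option.some.inj h
    exact hθ
  | succ k ih =>
    obtain ⟨J, hJ, t, ht, -, hstep⟩ := epochStep_of_epochs_succ_eq_some h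
    have hr := mem_reachable_of_epochs_eq_some hJ
    exact hstep.mem_Icc hη (quartile_mem_of_mem_reachable hr) (fun j => hdev k hk J hr j t ht)
      (ih (Nat.le_of_succ_le hk) hJ)

theorem epochs_terminates {gap : ℕ → ℝ} {τ : ℕ → ℕ} (hδ' : 0 < δ') (hle : δ' ≤ δ)
    (hη : IsThreshold η θ)
    (hgap : ∀ k < K, ∀ z ∈ Set.Icc (0 : ℝ) 1,
      ((2 : ℝ) ^ k)⁻¹ / 8 ≤ |z - θ| → gap k ≤ |η z - 1 / 2|)
    (hτ : ∀ k < K, 1 ≤ τ k) (hB : ∑ k ∈ Finset.range K, 3 * τ k ≤ B)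
    (hconf : ∀ k < K, 2 * conf (δ' / (K * 2 ^ (k + 1))) (τ k) ≤ gap k)
    (hdev : LineDeviation y η δ' K) (hk : k ≤ K) :
    ∃ I, (epochs y δ K B k).2 = some I ∧
      (epochs y δ K B k).1 ≤ ∑ i ∈ Finset.range k, 3 * τ i := by
  induction k with
  | zero => exact ⟨(0, 1), rfl, Nat.zero_le _⟩
  | succ k ih =>
    obtain ⟨I, hI, hcost⟩ := ih (Nat.le_of_succ_le hk)
    have hr := mem_reachable_of_epochs_eq_some hI
    have hK : (0 : ℝ) < K := by exact_mod_cast (Nat.succ_pos k).trans_le hk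
    have hconf_le : conf (δ / (K * 2 ^ (k + 1))) (τ k) ≤ conf (δ' / (K * 2 ^ (k + 1))) (τ k) :=
      conf_le_conf (by positivity) (by gcongr) (hτ k hk)
    obtain ⟨_, hstep⟩ := exists_epochStep hη (lt_of_mem_reachable hr)
      (quartile_mem_of_mem_reachable hr) (by rw [(mem_reachable hr).2.2]; exact hgap k hk)
      hconf_le (hconf k hk) fun j => hdev k hk I hr j (τ k) (hτ k hk)
    have hbudget := (Finset.sum_le_sum_of_subset (Finset.range_mono hk)).trans hB
    rw [Finset.sum_range_succ] at hbudget ⊢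
    obtain ⟨J, hJ, hrun⟩ := hstep.epochRun_terminates (B := B - (epochs y δ K B k).1) (hτ k hk)
      (by omega)
    rw [epochs_succ_of_some hI]
    exact ⟨J, hJ, Nat.add_le_add hcost hrun⟩

theorem inv_two_pow_numEpochs_le (hε : 0 < ε) : ((2 : ℝ) ^ numEpochs ε)⁻¹ ≤ 2 * ε := by
  have h : Real.logb 2 (1 / (2 * ε)) ≤ numEpochs ε := Nat.le_ceil _
  rw [Real.logb_le_iff_le_rpow one_lt_two (by positivity), Real.rpow_natCast, one_div] at h
  exact inv_le_of_inv_le₀ (by positivity) h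

theorem lineSearch_fst_le (y : ℕ → Fin 3 → ℕ → ℝ → Bool) (ε δ : ℝ) (B : ℕ) :
    (lineSearch y ε δ B).1 ≤ B := epochs_fst_le _ _ _ _ _

theorem exists_epochs_of_lineSearch_eq_some (h : (lineSearch y ε δ B).2 = some T) :
    ∃ I, (epochs y δ (numEpochs ε) B (numEpochs ε)).2 = some I ∧ (I.1 + I.2) / 2 = T :=
  Option.map_eq_some_iff.1 h

theorem mem_Icc_of_lineSearch_eq_some (h : (lineSearch y ε δ B).2 = some T) :
    T ∈ Set.Icc (0 : ℝ) 1 := by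
  obtain ⟨I, hI, rfl⟩ := exists_epochs_of_lineSearch_eq_some h
  exact quartile_mem_of_mem_reachable (mem_reachable_of_epochs_eq_some hI) 1

theorem lineSearch_fst_pos (hε : 0 < numEpochs ε) (h : (lineSearch y ε δ B).2 = some T) :
    0 < (lineSearch y ε δ B).1 := by
  obtain ⟨I, hI, -⟩ := exists_epochs_of_lineSearch_eq_some h
  simp only [lineSearch]
  obtain ⟨k, hk⟩ := Nat.exists_eq_succ_of_ne_zero hε.ne'
  rw [hk] at hI ⊢
  obtain ⟨-, -, t, ht, hcost, -⟩ := epochStep_of_epochs_succ_eq_some hI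
  rw [hcost]
  omega

theorem abs_lineSearch_sub_le (hε : 0 < ε) (hη : IsThreshold η θ)
    (hdev : LineDeviation y η δ (numEpochs ε)) (hθ : θ ∈ Set.Icc (0 : ℝ) 1)
    (h : (lineSearch y ε δ B).2 = some T) : |T - θ| ≤ ε := by
  obtain ⟨I, hI, rfl⟩ := exists_epochs_of_lineSearch_eq_some h
  obtain ⟨hleft, hright⟩ := mem_Icc_of_epochs_eq_some hη hdev hθ le_rfl hI
  have hlen := (mem_reachable (mem_reachable_of_epochs_eq_some hI)).2.2
  have hprec := inv_two_pow_numEpochs_le hε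
  exact abs_le.2 ⟨by linarith, by linarith⟩

theorem lineSearch_terminates {gap : ℕ → ℝ} {τ : ℕ → ℕ} (hδ' : 0 < δ') (hle : δ' ≤ δ)
    (hη : IsThreshold η θ)
    (hgap : ∀ k < numEpochs ε, ∀ z ∈ Set.Icc (0 : ℝ) 1,
      ((2 : ℝ) ^ k)⁻¹ / 8 ≤ |z - θ| → gap k ≤ |η z - 1 / 2|)
    (hτ : ∀ k < numEpochs ε, 1 ≤ τ k)
    (hB : ∑ k ∈ Finset.range (numEpochs ε), 3 * τ k ≤ B)
    (hconf : ∀ k < numEpochs ε, 2 * conf (δ' / (numEpochs ε * 2 ^ (k + 1))) (τ k) ≤ gap k)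
    (hdev : LineDeviation y η δ' (numEpochs ε)) :
    ∃ T, (lineSearch y ε δ B).2 = some T ∧
      (lineSearch y ε δ B).1 ≤ ∑ k ∈ Finset.range (numEpochs ε), 3 * τ k := by
  obtain ⟨I, hI, hcost⟩ := epochs_terminates hδ' hle hη hgap hτ hB hconf hdev le_rfl
  exact ⟨(I.1 + I.2) / 2, Option.map_eq_some_iff.2 ⟨I, hI, rfl⟩, hcost⟩

end LineSearch

/-! ### The main loop -/

section SearchLines

variable {d : ℕ} {y : Request d → Point d → Bool} {δ lam α : ℝ} {l B C : ℕ}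
  {a : Fin (d - 1) → ℕ} {as : List (Fin (d - 1) → ℕ)} {T : (Fin (d - 1) → ℕ) → ℝ}

theorem searchLines_cons_of_some (h : (searchLines y δ lam α l B as).2 = some T) :
    searchLines y δ lam α l B (a :: as) =
      ((searchLines y δ lam α l B as).1 +
        (searchLine y δ lam α l a (B - (searchLines y δ lam α l B as).1)).1,
        (searchLine y δ lam α l a (B - (searchLines y δ lam α l B as).1)).2.map
          fun τ => Function.update T a τ) := by
  rw [searchLines]
  rcases hE : searchLines y δ lam α l B as with ⟨N, _ | T'⟩ <;> rw [hE] at h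
  · cases h
  · obtain rfl : T' = T := Option.some.inj h
    rfl

theorem searchLines_cons_of_none (h : (searchLines y δ lam α l B as).2 = none) :
    searchLines y δ lam α l B (a :: as) = searchLines y δ lam α l B as := by
  rw [searchLines]
  rcases hE : searchLines y δ lam α l B as with ⟨N, _ | T'⟩
  · rfl
  · cases (congrArg Prod.snd hE).symm.trans h

theorem exists_of_searchLines_cons_eq_some (h : (searchLines y δ lam α l B (a :: as)).2 = some T) :
    ∃ T' τ, (searchLines y δ lam α l B as).2 = some T' ∧
      (searchLine y δ lam α l a (B - (searchLines y δ lam α l B as).1)).2 = some τ ∧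
      Function.update T' a τ = T := by
  rcases hE : (searchLines y δ lam α l B as).2 with _ | T'
  · rw [searchLines_cons_of_none hE, hE] at h
    cases h
  · rw [searchLines_cons_of_some hE] at h
    obtain ⟨τ, hτ, hT⟩ := Option.map_eq_some_iff.1 h
    exact ⟨T', τ, rfl, hτ, hT⟩

theorem searchLines_fst_le (y : Request d → Point d → Bool) (δ lam α : ℝ) (l B : ℕ)
    (as : List (Fin (d - 1) → ℕ)) : (searchLines y δ lam α l B as).1 ≤ B := by
  induction as with
  | nil => exact Nat.zero_le B
  | cons a as ih =>
    rcases hE : (searchLines y δ lam α l B as).2 with _ | T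
    · rwa [searchLines_cons_of_none hE]
    · rw [searchLines_cons_of_some hE]
      exact Nat.add_le_of_le_sub' ih (lineSearch_fst_le _ _ _ _)

theorem exists_searchLine_of_searchLines_eq_some (h : (searchLines y δ lam α l B as).2 = some T)
    (ha : a ∈ as) : ∃ B', (searchLine y δ lam α l a B').2 = some (T a) := by
  induction as generalizing T with
  | nil => cases ha
  | cons b as ih =>
    obtain ⟨T', τ, hT', hτ, rfl⟩ := exists_of_searchLines_cons_eq_some h
    by_cases hab : a = b
    · subst hab
      exact ⟨_, by rw [Function.update_self, hτ]⟩
    · rw [Function.update_of_ne hab]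
      exact ih hT' ((List.mem_cons.1 ha).resolve_left hab)

theorem searchLines_fst_pos (has : as ≠ []) (hε : 0 < numEpochs (precision lam α l))
    (h : (searchLines y δ lam α l B as).2 = some T) : 0 < (searchLines y δ lam α l B as).1 := by
  obtain ⟨a, as, rfl⟩ := List.exists_cons_of_ne_nil has
  obtain ⟨T', τ, hT', hτ, -⟩ := exists_of_searchLines_cons_eq_some h
  rw [searchLines_cons_of_some hT']
  exact Nat.add_pos_right _ (lineSearch_fst_pos hε hτ)

theorem searchLines_terminates
    (hline : ∀ a ∈ as, ∀ B', C ≤ B' →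
      ∃ τ, (searchLine y δ lam α l a B').2 = some τ ∧ (searchLine y δ lam α l a B').1 ≤ C)
    (hB : as.length * C ≤ B) :
    ∃ T, (searchLines y δ lam α l B as).2 = some T ∧
      (searchLines y δ lam α l B as).1 ≤ as.length * C := by
  induction as with
  | nil => exact ⟨0, rfl, Nat.zero_le _⟩
  | cons a as ih =>
    rw [List.length_cons, Nat.succ_mul] at hB ⊢
    obtain ⟨T, hT, hcost⟩ := ih (fun b hb => hline b (List.mem_cons_of_mem _ hb)) (by omega)
    obtain ⟨τ, hτ, hcost'⟩ := hline a List.mem_cons_self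
      (B - (searchLines y δ lam α l B as).1) (by omega)
    rw [searchLines_cons_of_some hT]
    exact ⟨_, Option.map_eq_some_iff.2 ⟨τ, hτ, rfl⟩, Nat.add_le_add hcost hcost'⟩

end SearchLines

section MainLoop

variable {d : ℕ} {y : Request d → Point d → Bool} {n : ℕ} {δ lam α : ℝ} {l : ℕ}
  {T : (Fin (d - 1) → ℕ) → ℝ}

theorem mainLoop_succ_of_isSome (h : (mainLoop y n δ lam α l).2.isSome)
    (hlt : (mainLoop y n δ lam α l).1 < n) :
    mainLoop y n δ lam α (l + 1) =
      ((mainLoop y n δ lam α l).1 + (searchLines y δ lam α (l + 1)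
          (n - (mainLoop y n δ lam α l).1) (lineIndices d α (l + 1)).toList).1,
        (searchLines y δ lam α (l + 1)
          (n - (mainLoop y n δ lam α l).1) (lineIndices d α (l + 1)).toList).2) := by
  rw [mainLoop]
  rcases hE : mainLoop y n δ lam α l with ⟨N, _ | T⟩ <;> rw [hE] at h hlt
  · cases h
  · exact if_pos hlt

theorem mainLoop_succ_of_not
    (h : ¬ ((mainLoop y n δ lam α l).2.isSome ∧ (mainLoop y n δ lam α l).1 < n)) :
    mainLoop y n δ lam α (l + 1) = ((mainLoop y n δ lam α l).1, none) := by
  rw [mainLoop]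
  rcases hE : mainLoop y n δ lam α l with ⟨N, _ | T⟩
  · rfl
  · rw [hE] at h
    exact if_neg fun hlt => h ⟨rfl, hlt⟩

theorem searchLines_of_mainLoop_succ_eq_some (h : (mainLoop y n δ lam α (l + 1)).2 = some T) :
    (mainLoop y n δ lam α l).2.isSome ∧ (mainLoop y n δ lam α l).1 < n ∧
      (searchLines y δ lam α (l + 1)
          (n - (mainLoop y n δ lam α l).1) (lineIndices d α (l + 1)).toList).2 = some T := by
  by_cases hc : (mainLoop y n δ lam α l).2.isSome ∧ (mainLoop y n δ lam α l).1 < n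
  · rw [mainLoop_succ_of_isSome hc.1 hc.2] at h
    exact ⟨hc.1, hc.2, h⟩
  · rw [mainLoop_succ_of_not hc] at h
    cases h

theorem mainLoop_fst_le (y : Request d → Point d → Bool) (n : ℕ) (δ lam α : ℝ) (l : ℕ) :
    (mainLoop y n δ lam α l).1 ≤ n := by
  induction l with
  | zero => exact Nat.zero_le n
  | succ l ih =>
    by_cases hc : (mainLoop y n δ lam α l).2.isSome ∧ (mainLoop y n δ lam α l).1 < n
    · rw [mainLoop_succ_of_isSome hc.1 hc.2]
      exact Nat.add_le_of_le_sub' ih (searchLines_fst_le _ _ _ _ _ _ _)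
    · rwa [mainLoop_succ_of_not hc]

theorem lineIndices_toList_ne_nil (d : ℕ) (α : ℝ) (l : ℕ) : (lineIndices d α l).toList ≠ [] :=
  Finset.Nonempty.toList_ne_nil ⟨0, by simp [lineIndices, Fintype.mem_piFinset]⟩

theorem card_lineIndices (d : ℕ) (α : ℝ) (l : ℕ) :
    (lineIndices d α l).card = (gridSize α l + 1) ^ (d - 1) := by
  simp [lineIndices, Fintype.card_piFinset]

theorem exists_searchLine_of_mainLoop_eq_some (hl : 1 ≤ l)
    (h : (mainLoop y n δ lam α l).2 = some T) {a : Fin (d - 1) → ℕ}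
    (ha : a ∈ lineIndices d α l) : ∃ B, (searchLine y δ lam α l a B).2 = some (T a) := by
  obtain ⟨l, rfl⟩ := Nat.exists_eq_add_of_le' hl
  exact exists_searchLine_of_searchLines_eq_some (searchLines_of_mainLoop_succ_eq_some h).2.2
    (Finset.mem_toList.2 ha)

theorem mainLoop_terminates {L : ℕ} {C : ℕ → ℕ}
    (hline : ∀ l, 1 ≤ l → l ≤ L → ∀ a ∈ lineIndices d α l, ∀ B, C l ≤ B →
      ∃ τ, (searchLine y δ lam α l a B).2 = some τ ∧ (searchLine y δ lam α l a B).1 ≤ C l)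
    (hn : ∑ l ∈ Finset.range L, (gridSize α (l + 1) + 1) ^ (d - 1) * C (l + 1) < n)
    (hl : l ≤ L) :
    (mainLoop y n δ lam α l).2.isSome ∧ (mainLoop y n δ lam α l).1
      ≤ ∑ i ∈ Finset.range l, (gridSize α (i + 1) + 1) ^ (d - 1) * C (i + 1) := by
  induction l with
  | zero => exact ⟨rfl, Nat.zero_le _⟩
  | succ l ih =>
    obtain ⟨hsome, hcost⟩ := ih (Nat.le_of_succ_le hl)
    have hbudget := (Finset.sum_le_sum_of_subset (Finset.range_mono hl)).trans_lt hn
    rw [Finset.sum_range_succ] at hbudget ⊢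
    obtain ⟨T, hT, hcost'⟩ := searchLines_terminates (B := n - (mainLoop y n δ lam α l).1)
      (as := (lineIndices d α (l + 1)).toList) (C := C (l + 1))
      (fun a ha => hline (l + 1) l.succ_pos hl a (Finset.mem_toList.1 ha))
      (by rw [Finset.length_toList, card_lineIndices]; omega)
    rw [Finset.length_toList, card_lineIndices] at hcost'
    rw [mainLoop_succ_of_isSome hsome (by omega)]
    exact ⟨by rw [hT]; rfl, Nat.add_le_add hcost hcost'⟩

end MainLoop

/-! ### The last completed depth -/

section FinalDepth

variable {d : ℕ} {y : Request d → Point d → Bool} {n : ℕ} {δ lam α : ℝ}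

theorem precision_eq (lam α : ℝ) (l : ℕ) : precision lam α l = lam * (((2 : ℝ) ^ l) ^ α)⁻¹ := by
  rw [precision, Real.rpow_neg zero_le_two, Real.rpow_mul zero_le_two, Real.rpow_natCast]

theorem precision_pos (hlam : 0 < lam) (α : ℝ) (l : ℕ) : 0 < precision lam α l :=
  mul_pos hlam (Real.rpow_pos_of_pos two_pos _)

theorem tendsto_precision (lam : ℝ) (hα : 0 < α) :
    Filter.Tendsto (precision lam α) Filter.atTop (nhds 0) := by
  have h := (tendsto_rpow_neg_atTop hα).comp
    (tendsto_pow_atTop_atTop_of_one_lt (one_lt_two (α := ℝ)))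
  rw [← mul_zero lam]
  refine (h.const_mul lam).congr fun l => ?_
  rw [precision_eq, Function.comp_apply, Real.rpow_neg (by positivity)]

theorem numEpochs_pos {ε : ℝ} (hε : 0 < ε) (hε' : ε < 1 / 2) : 0 < numEpochs ε :=
  Nat.ceil_pos.2 (Real.logb_pos one_lt_two (by rw [lt_div_iff₀ (by positivity)]; linarith))

theorem isSome_mainLoop_of_le {l l' : ℕ} (hle : l ≤ l') (h : (mainLoop y n δ lam α l').2.isSome) :
    (mainLoop y n δ lam α l).2.isSome := by
  induction l', hle using Nat.le_induction with
  | base => exact h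
  | succ l' _ ih =>
    obtain ⟨T, hT⟩ := Option.isSome_iff_exists.1 h
    exact ih (searchLines_of_mainLoop_succ_eq_some hT).1

theorem mainLoop_fst_lt_succ {l : ℕ} (hε : 0 < numEpochs (precision lam α (l + 1)))
    (h : (mainLoop y n δ lam α (l + 1)).2.isSome) :
    (mainLoop y n δ lam α l).1 < (mainLoop y n δ lam α (l + 1)).1 := by
  obtain ⟨T, hT⟩ := Option.isSome_iff_exists.1 h
  obtain ⟨hsome, hlt, hT⟩ := searchLines_of_mainLoop_succ_eq_some hT
  rw [mainLoop_succ_of_isSome hsome hlt]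
  exact Nat.lt_add_of_pos_right (searchLines_fst_pos (lineIndices_toList_ne_nil d α _) hε hT)

variable (y n δ) in
/-- Once the precision is below `1/2`, every completed depth costs at least one label. -/
theorem bddAbove_completedDepths (hlam : 0 < lam) (hα : 0 < α) :
    BddAbove {l | (mainLoop y n δ lam α l).2.isSome} := by
  obtain ⟨l₀, hl₀⟩ := Filter.eventually_atTop.1
    ((tendsto_precision lam hα).eventually_lt_const (one_half_pos (α := ℝ)))
  have le_cost : ∀ j, (mainLoop y n δ lam α (l₀ + j)).2.isSome →
      j ≤ (mainLoop y n δ lam α (l₀ + j)).1 := by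
    intro j
    induction j with
    | zero => exact fun _ => Nat.zero_le _
    | succ j ih =>
      intro h
      have hε := numEpochs_pos (precision_pos hlam α _) (hl₀ (l₀ + j + 1) (by omega))
      exact Nat.succ_le_of_lt
        ((ih (isSome_mainLoop_of_le (Nat.le_succ _) h)).trans_lt (mainLoop_fst_lt_succ hε h))
  refine ⟨l₀ + n, fun l hl => ?_⟩
  by_contra! hlt
  have hcost := le_cost (n + 1) (isSome_mainLoop_of_le hlt hl)
  have hbudget := mainLoop_fst_le y n δ lam α (l₀ + (n + 1))
  omega

variable (y n δ) in
theorem mainLoop_finalDepth_eq (hlam : 0 < lam) (hα : 0 < α) :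
    (mainLoop y n δ lam α (finalDepth y n δ lam α)).2 = some (thresholds y n δ lam α) := by
  have h : (mainLoop y n δ lam α (finalDepth y n δ lam α)).2.isSome :=
    Nat.sSup_mem (s := {l | (mainLoop y n δ lam α l).2.isSome}) ⟨0, rfl⟩
      (bddAbove_completedDepths y n δ hlam hα)
  obtain ⟨T, hT⟩ := Option.isSome_iff_exists.1 h
  rw [thresholds, hT, Option.getD_some]

theorem le_finalDepth (hlam : 0 < lam) (hα : 0 < α) {l : ℕ}
    (h : (mainLoop y n δ lam α l).2.isSome) : l ≤ finalDepth y n δ lam α :=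
  le_csSup (bddAbove_completedDepths y n δ hlam hα) h

end FinalDepth

/-! ### Deviation bounds -/

section Hoeffding

variable {Ω : Type*} [MeasurableSpace Ω] {μ : Measure Ω}

theorem measure_le_abs_sum_range_le {X : ℕ → Ω → ℝ} (hindep : iIndepFun X μ) {c : NNReal} {n : ℕ}
    (hX : ∀ i < n, HasSubgaussianMGF (X i) c μ) {r : ℝ} (hr : 0 ≤ r) :
    μ {ω | r ≤ |∑ i ∈ Finset.range n, X i ω|} ≤
      ENNReal.ofReal (2 * Real.exp (-r ^ 2 / (2 * n * c))) := by
  have := hindep.isProbabilityMeasure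
  have hupper := HasSubgaussianMGF.measure_sum_range_ge_le_of_iIndepFun hindep hX hr
  have hlower := HasSubgaussianMGF.measure_sum_range_ge_le_of_iIndepFun
    (hindep.comp (fun _ => Neg.neg) fun _ => measurable_neg) (fun i hi => (hX i hi).neg) hr
  have hcover : {ω | r ≤ |∑ i ∈ Finset.range n, X i ω|} ⊆
      {ω | r ≤ ∑ i ∈ Finset.range n, X i ω} ∪ {ω | r ≤ ∑ i ∈ Finset.range n, -X i ω} := by
    intro ω hω
    rw [Set.mem_ofPred_eq, le_abs] at hω
    simpa only [Set.mem_union, Set.mem_ofPred_eq, Finset.sum_neg_distrib] using hω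
  rw [← ofReal_measureReal]
  refine ENNReal.ofReal_le_ofReal ((measureReal_mono hcover).trans ?_)
  refine (measureReal_union_le _ _).trans ?_
  rw [two_mul]
  exact add_le_add hupper hlower

theorem hasSubgaussianMGF_indicator_sub [IsProbabilityMeasure μ] {s : Set Ω}
    (hs : MeasurableSet s) {p : ℝ} (hp : 0 ≤ p) (hμ : μ s = ENNReal.ofReal p) :
    HasSubgaussianMGF (fun ω => s.indicator (fun _ => 1) ω - p) ((1 / 2) ^ 2) μ := by
  have hintegral : ∫ ω, s.indicator (fun _ => (1 : ℝ)) ω ∂μ = p := by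
    rw [integral_indicator_const _ hs, Measure.real, hμ, ENNReal.toReal_ofReal hp, smul_eq_mul,
      mul_one]
  have h := hasSubgaussianMGF_of_mem_Icc (μ := μ) (X := s.indicator fun _ => (1 : ℝ))
    (a := 0) (b := 1) (measurable_const.indicator hs).aemeasurable
    (Filter.Eventually.of_forall fun ω =>
      ⟨Set.indicator_nonneg (fun _ _ => zero_le_one) ω, Set.indicator_le_self' (by simp) ω⟩)
  rw [hintegral] at h
  simpa using h

theorem measure_le_abs_empMean_sub_le {Y : ℕ → Ω → Bool} (hY : ∀ i, Measurable (Y i))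
    (hindep : iIndepFun Y μ) {p : ℝ} (hp : 0 ≤ p)
    (hlaw : ∀ i, μ {ω | Y i ω = true} = ENNReal.ofReal p) {t : ℕ} (ht : 1 ≤ t) {r : ℝ}
    (hr : 0 ≤ r) :
    μ {ω | r ≤ |empMean (fun i => Y i ω) t - p|} ≤
      ENNReal.ofReal (2 * Real.exp (-2 * t * r ^ 2)) := by
  have := hindep.isProbabilityMeasure
  have hpos : (0 : ℝ) < t := by exact_mod_cast ht
  have hsub : ∀ i, HasSubgaussianMGF (fun ω => (if Y i ω then (1 : ℝ) else 0) - p)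
      ((1 / 2) ^ 2) μ := fun i => by
    convert! hasSubgaussianMGF_indicator_sub (hY i (measurableSet_singleton true)) hp (hlaw i)
    classical
    rw [Set.indicator_apply]
    congr 1
  have hbound := measure_le_abs_sum_range_le (n := t) (r := t * r)
    (hindep.comp (fun _ b => (if b then (1 : ℝ) else 0) - p) fun _ => measurable_of_countable _)
    (fun i _ => hsub i) (by positivity)
  have hmean : ∀ ω, ∑ i ∈ Finset.range t, ((if Y i ω then (1 : ℝ) else 0) - p) =
      t * (empMean (fun i => Y i ω) t - p) := fun ω => by
    rw [Finset.sum_sub_distrib, empMean, Finset.sum_const, Finset.card_range, nsmul_eq_mul]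
    field_simp
  have hexp : -(t * r) ^ 2 / (2 * t * (((1 / 2 : NNReal) ^ 2 : NNReal) : ℝ)) = -2 * t * r ^ 2 := by
    push_cast
    field_simp
  simpa only [Function.comp_def, hmean, abs_mul, abs_of_pos hpos, mul_le_mul_iff_right₀ hpos, hexp]
    using hbound

theorem conf_nonneg (δ : ℝ) (t : ℕ) : 0 ≤ conf δ t := by
  unfold conf
  positivity

theorem exp_neg_two_mul_conf_sq {δ : ℝ} (hδ : 0 < δ) (hδ1 : δ ≤ 1) {t : ℕ} (ht : 1 ≤ t) :
    Real.exp (-2 * t * conf δ t ^ 2) = (δ / t) ^ 4 := by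
  have ht1 : (1 : ℝ) ≤ t := by exact_mod_cast ht
  have : (0 : ℝ) < t := by linarith
  have hlog : 0 ≤ Real.log (t / δ) := Real.log_nonneg ((one_le_div hδ).2 (hδ1.trans ht1))
  have harg : -2 * t * conf δ t ^ 2 = ((4 : ℕ) : ℝ) * Real.log (δ / t) := by
    rw [conf, mul_pow, Real.sq_sqrt (by positivity), ← inv_div (t : ℝ) δ, Real.log_inv]
    field_simp
    ring
  rw [harg, Real.exp_nat_mul, Real.exp_log (by positivity)]

theorem sum_range_inv_succ_pow_four_le (N : ℕ) :
    ∑ t ∈ Finset.range N, (((t + 1 : ℕ) : ℝ) ^ 4)⁻¹ ≤ 2 := by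
  calc ∑ t ∈ Finset.range N, (((t + 1 : ℕ) : ℝ) ^ 4)⁻¹
      ≤ ∑ t ∈ Finset.range N, (((t + 1 : ℕ) : ℝ) ^ 2)⁻¹ := by
        gcongr <;> norm_num
    _ = ∑ t ∈ Finset.Ioo 0 (N + 1), ((t : ℝ) ^ 2)⁻¹ := by
        rw [Finset.range_eq_Ico, Finset.sum_Ico_add' (fun t : ℕ => ((t : ℝ) ^ 2)⁻¹)]
        rfl
    _ ≤ 2 := by simpa using sum_Ioo_inv_sq_le (α := ℝ) 0 (N + 1)

theorem measure_exists_conf_le {Y : ℕ → Ω → Bool} (hY : ∀ i, Measurable (Y i))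
    (hindep : iIndepFun Y μ) {p : ℝ} (hp : 0 ≤ p)
    (hlaw : ∀ i, μ {ω | Y i ω = true} = ENNReal.ofReal p) {δ : ℝ} (hδ : 0 < δ) (hδ1 : δ ≤ 1) :
    μ {ω | ∃ t, 1 ≤ t ∧ conf δ t ≤ |empMean (fun i => Y i ω) t - p|} ≤
      ENNReal.ofReal (4 * δ ^ 4) := by
  have hcover : {ω | ∃ t, 1 ≤ t ∧ conf δ t ≤ |empMean (fun i => Y i ω) t - p|} ⊆
      ⋃ t : ℕ, {ω | conf δ (t + 1) ≤ |empMean (fun i => Y i ω) (t + 1) - p|} := by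
    rintro ω ⟨t, ht, h⟩
    obtain ⟨s, rfl⟩ := Nat.exists_eq_add_of_le' ht
    exact Set.mem_iUnion.2 ⟨s, h⟩
  have hround : ∀ t : ℕ, μ {ω | conf δ (t + 1) ≤ |empMean (fun i => Y i ω) (t + 1) - p|} ≤
      ENNReal.ofReal (2 * (δ / (t + 1 : ℕ)) ^ 4) := fun t => by
    rw [← exp_neg_two_mul_conf_sq hδ hδ1 t.succ_pos]
    exact measure_le_abs_empMean_sub_le hY hindep hp hlaw t.succ_pos (conf_nonneg δ _)
  refine (measure_mono hcover).trans <| (measure_iUnion_le _).trans <|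
    ENNReal.tsum_le_of_sum_range_le fun N => (Finset.sum_le_sum fun t _ => hround t).trans ?_
  rw [← ENNReal.ofReal_sum_of_nonneg fun _ _ => by positivity]
  refine ENNReal.ofReal_le_ofReal ?_
  calc ∑ t ∈ Finset.range N, 2 * (δ / (t + 1 : ℕ)) ^ 4
      = 2 * δ ^ 4 * ∑ t ∈ Finset.range N, (((t + 1 : ℕ) : ℝ) ^ 4)⁻¹ := by
        rw [Finset.mul_sum]
        exact Finset.sum_congr rfl fun t _ => by rw [div_pow, div_eq_mul_inv, mul_assoc]
    _ ≤ 2 * δ ^ 4 * 2 := by gcongr; exact sum_range_inv_succ_pow_four_le N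
    _ = 4 * δ ^ 4 := by ring

end Hoeffding

section LineDeviation

variable {Ω : Type*} [MeasurableSpace Ω] {μ : Measure Ω} {Y : ℕ → Fin 3 → ℕ → ℝ → Ω → Bool}
  {η : ℝ → ℝ} {δ : ℝ}

theorem measure_exists_quartileMean_deviation_le (hY : ∀ k j i z, Measurable (Y k j i z))
    (hindep : ∀ k j z, iIndepFun (fun i => Y k j i z) μ)
    (hη : ∀ z ∈ Set.Icc (0 : ℝ) 1, 0 ≤ η z)
    (hlaw : ∀ k j i, ∀ z ∈ Set.Icc (0 : ℝ) 1, μ {ω | Y k j i z ω = true} = ENNReal.ofReal (η z))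
    (hδ : 0 < δ) (hδ1 : δ ≤ 1) {k K : ℕ} (hk : k < K) {I : ℝ × ℝ} (hI : I ∈ reachable k)
    (j : Fin 3) :
    μ {ω | ∃ t, 1 ≤ t ∧ conf (δ / (K * 2 ^ (k + 1))) t ≤
        |quartileMean (fun j i z => Y (k + 1) j i z ω) I j t - η (quartile j I)|} ≤
      ENNReal.ofReal (4 * δ ^ 4 / 16 ^ (k + 1)) := by
  have hz := quartile_mem_of_mem_reachable hI j
  have hK : (1 : ℝ) ≤ K := by exact_mod_cast (Nat.succ_pos k).trans_le hk
  have hle : δ / (K * 2 ^ (k + 1)) ≤ δ / 2 ^ (k + 1) := by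
    gcongr
    exact le_mul_of_one_le_left (by positivity) hK
  have hle_one : δ / (2 : ℝ) ^ (k + 1) ≤ 1 :=
    (div_le_self hδ.le (one_le_pow₀ one_le_two)).trans hδ1
  refine (measure_exists_conf_le (fun i => hY (k + 1) j i _) (hindep (k + 1) j _) (hη _ hz)
    (fun i => hlaw (k + 1) j i _ hz) (by positivity) (hle.trans hle_one)).trans
    (ENNReal.ofReal_le_ofReal ?_)
  calc 4 * (δ / (K * 2 ^ (k + 1))) ^ 4 ≤ 4 * (δ / 2 ^ (k + 1)) ^ 4 := by gcongr
    _ = 4 * δ ^ 4 / 16 ^ (k + 1) := by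
      rw [div_pow, ← pow_mul, mul_comm (k + 1) 4, pow_mul, mul_div_assoc]
      norm_num

theorem sum_range_epoch_weights_le (K : ℕ) :
    ∑ k ∈ Finset.range K, 3 ^ k * 3 * (4 / 16 ^ (k + 1) : ℝ) ≤ 1 := by
  calc ∑ k ∈ Finset.range K, 3 ^ k * 3 * (4 / 16 ^ (k + 1) : ℝ)
      = 3 / 4 * ∑ k ∈ Finset.range K, (3 / 16 : ℝ) ^ k := by
        rw [Finset.mul_sum]
        refine Finset.sum_congr rfl fun k _ => ?_
        rw [div_pow, pow_succ]
        field_simp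
        norm_num
    _ ≤ 3 / 4 * ((3 / 16) ^ 0 / (1 - 3 / 16)) := by
        rw [Finset.range_eq_Ico]
        gcongr
        exact geom_sum_Ico_le_of_lt_one (by norm_num) (by norm_num)
    _ ≤ 1 := by norm_num

theorem sum_card_reachable_mul_le (δ : ℝ) (K : ℕ) :
    ∑ k ∈ Finset.range K, ((reachable k ×ˢ (Finset.univ : Finset (Fin 3))).card : ℝ) *
      (4 * δ ^ 4 / 16 ^ (k + 1)) ≤ δ ^ 4 := by
  have hcard : ∀ k, ((reachable k ×ˢ (Finset.univ : Finset (Fin 3))).card : ℝ) ≤ 3 ^ k * 3 :=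
    fun k => by
      rw [Finset.card_product, Finset.card_fin]
      exact_mod_cast Nat.mul_le_mul_right 3 (card_reachable_le k)
  calc _ ≤ ∑ k ∈ Finset.range K, 3 ^ k * 3 * (4 * δ ^ 4 / 16 ^ (k + 1)) := by
        gcongr with k
        exact hcard k
    _ = δ ^ 4 * ∑ k ∈ Finset.range K, 3 ^ k * 3 * (4 / 16 ^ (k + 1)) := by
        rw [Finset.mul_sum]
        exact Finset.sum_congr rfl fun k _ => by ring
    _ ≤ δ ^ 4 := mul_le_of_le_one_right (by positivity) (sum_range_epoch_weights_le K)

theorem measure_not_lineDeviation_le (hY : ∀ k j i z, Measurable (Y k j i z))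
    (hindep : ∀ k j z, iIndepFun (fun i => Y k j i z) μ)
    (hη : ∀ z ∈ Set.Icc (0 : ℝ) 1, 0 ≤ η z)
    (hlaw : ∀ k j i, ∀ z ∈ Set.Icc (0 : ℝ) 1, μ {ω | Y k j i z ω = true} = ENNReal.ofReal (η z))
    (hδ : 0 < δ) (hδ1 : δ ≤ 1) (K : ℕ) :
    μ {ω | ¬ LineDeviation (fun k j i z => Y k j i z ω) η δ K} ≤ ENNReal.ofReal (δ ^ 4) := by
  have hcover : {ω | ¬ LineDeviation (fun k j i z => Y k j i z ω) η δ K} ⊆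
      ⋃ k ∈ Finset.range K, ⋃ p ∈ reachable k ×ˢ (Finset.univ : Finset (Fin 3)),
        {ω | ∃ t, 1 ≤ t ∧ conf (δ / (K * 2 ^ (k + 1))) t ≤
          |quartileMean (fun j i z => Y (k + 1) j i z ω) p.1 p.2 t - η (quartile p.2 p.1)|} := by
    intro ω hω
    simp only [Set.mem_ofPred_eq, LineDeviation] at hω
    push Not at hω
    obtain ⟨k, hk, I, hI, j, t, ht, h⟩ := hω
    simp only [Set.mem_iUnion]
    exact ⟨k, Finset.mem_range.2 hk, (I, j), Finset.mk_mem_product hI (Finset.mem_univ j), t, ht, h⟩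
  calc μ {ω | ¬ LineDeviation (fun k j i z => Y k j i z ω) η δ K}
      ≤ ∑ k ∈ Finset.range K, ∑ _p ∈ reachable k ×ˢ (Finset.univ : Finset (Fin 3)),
          ENNReal.ofReal (4 * δ ^ 4 / 16 ^ (k + 1)) := by
        refine (measure_mono hcover).trans <| (measure_biUnion_finset_le _ _).trans <|
          Finset.sum_le_sum fun k hk => (measure_biUnion_finset_le _ _).trans <|
          Finset.sum_le_sum fun p hp => ?_
        exact measure_exists_quartileMean_deviation_le hY hindep hη hlaw hδ hδ1
          (Finset.mem_range.1 hk) (Finset.mem_product.1 hp).1 p.2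
    _ = ENNReal.ofReal (∑ k ∈ Finset.range K,
          (reachable k ×ˢ (Finset.univ : Finset (Fin 3))).card * (4 * δ ^ 4 / 16 ^ (k + 1))) := by
        rw [ENNReal.ofReal_sum_of_nonneg fun _ _ => by positivity]
        refine Finset.sum_congr rfl fun k _ => ?_
        rw [Finset.sum_const, nsmul_eq_mul, ENNReal.ofReal_mul (Nat.cast_nonneg _),
          ENNReal.ofReal_natCast]
    _ ≤ ENNReal.ofReal (δ ^ 4) :=
      ENNReal.ofReal_le_ofReal (sum_card_reachable_mul_le δ K)

end LineDeviation

/-! ### The good event -/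

section GoodEvent

variable {d l : ℕ} {δ lam α : ℝ}

/-- Confidence parameter of the deviation bounds at depth `l`. While `2 ^ (l + 1) ≤ ⌈α⌉` there are
too many lines for a union bound at level `depthConf`, so a smaller parameter is used. At such
depths only the cost of the line searches matters: the algorithm labels no point after them. -/
noncomputable def levelConf (d : ℕ) (δ α : ℝ) (l : ℕ) : ℝ :=
  if 2 ^ (l + 1) ≤ ⌈α⌉₊ then depthConf d δ α l / (cellNodes α : ℝ) ^ d else depthConf d δ α l

/-- The good event: the labels seen by each line search of the algorithm have small deviations,
in the sense of `LineDeviation` with the parameter `levelConf`. -/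
def AllDeviation (P : ClassificationProblem d) (δ lam α : ℝ)
    (y : Request d → Point d → Bool) : Prop :=
  ∀ l, 1 ≤ l → ∀ a ∈ lineIndices d α l,
    LineDeviation (fun k j i z => y ⟨l, a, k, j, i⟩ (gridPoint α l a, z))
      (fun z => P.eta (gridPoint α l a, z)) (levelConf d δ α l) (numEpochs (precision lam α l))

theorem depthConf_pos (d : ℕ) (hδ : 0 < δ) (α : ℝ) (l : ℕ) : 0 < depthConf d δ α l := by
  have hm : (0 : ℝ) < cellNodes α := by exact_mod_cast one_le_cellNodes α
  unfold depthConf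
  positivity

theorem depthConf_le (d : ℕ) (hδ : 0 ≤ δ) (α : ℝ) (l : ℕ) : depthConf d δ α l ≤ δ := by
  have hm : (1 : ℝ) ≤ cellNodes α := by exact_mod_cast one_le_cellNodes α
  exact div_le_self hδ (one_le_mul_of_one_le_of_one_le hm (one_le_pow₀ one_le_two))

theorem depthConf_div_le_levelConf (d : ℕ) (hδ : 0 < δ) (α : ℝ) (l : ℕ) :
    depthConf d δ α l / (cellNodes α : ℝ) ^ d ≤ levelConf d δ α l := by
  have hm : (1 : ℝ) ≤ cellNodes α := by exact_mod_cast one_le_cellNodes α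
  unfold levelConf
  split_ifs
  · rfl
  · exact div_le_self (depthConf_pos d hδ α l).le (one_le_pow₀ hm)

theorem levelConf_pos (d : ℕ) (hδ : 0 < δ) (α : ℝ) (l : ℕ) : 0 < levelConf d δ α l := by
  have hm : (0 : ℝ) < cellNodes α := by exact_mod_cast one_le_cellNodes α
  have hpos := depthConf_pos d hδ α l
  exact (by positivity : 0 < depthConf d δ α l / (cellNodes α : ℝ) ^ d).trans_le
    (depthConf_div_le_levelConf d hδ α l)

theorem levelConf_le_depthConf (d : ℕ) (hδ : 0 < δ) (α : ℝ) (l : ℕ) :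
    levelConf d δ α l ≤ depthConf d δ α l := by
  have hm : (1 : ℝ) ≤ cellNodes α := by exact_mod_cast one_le_cellNodes α
  unfold levelConf
  split_ifs
  · exact div_le_self (depthConf_pos d hδ α l).le (one_le_pow₀ hm)
  · rfl

theorem cellNodes_le_ceil (hα : 0 < α) : cellNodes α ≤ ⌈α⌉₊ := by
  have hceil := Nat.ceil_pos.2 hα
  rw [cellNodes, strictFloor]
  omega

theorem gridSize_add_one_le (α : ℝ) (hl : 1 ≤ l) :
    (gridSize α l : ℝ) + 1 ≤ cellNodes α * (2 ^ l) ^ 2 := by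
  have hm : (1 : ℝ) ≤ cellNodes α := by exact_mod_cast one_le_cellNodes α
  have hx : (2 : ℝ) ≤ 2 ^ l := by simpa only [pow_one] using pow_le_pow_right₀ one_le_two hl
  rw [gridSize]
  push_cast
  nlinarith [mul_nonneg (sub_nonneg.2 hm) (sub_nonneg.2 hx)]

theorem levelConf_eq_div (d : ℕ) (δ α : ℝ) (l : ℕ) :
    levelConf (d + 1) δ α l =
      δ / (cellNodes α * (2 ^ l) ^ (d + 2) *
        if 2 ^ (l + 1) ≤ ⌈α⌉₊ then (cellNodes α : ℝ) ^ (d + 1) else 1) := by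
  rw [levelConf, depthConf, pow_mul]
  split_ifs
  · rw [div_div]
  · rw [mul_one]

theorem pow_mul_two_pow_le_levelConf_denom (d : ℕ) (hα : 0 < α) (hl : 1 ≤ l) :
    ((cellNodes α : ℝ) * (2 ^ l) ^ 2) ^ d * 2 ^ l ≤
      (cellNodes α * (2 ^ l) ^ (d + 2) *
        if 2 ^ (l + 1) ≤ ⌈α⌉₊ then (cellNodes α : ℝ) ^ (d + 1) else 1) ^ 4 := by
  have hm : (1 : ℝ) ≤ cellNodes α := by exact_mod_cast one_le_cellNodes α
  have hm_le : ⌈α⌉₊ < 2 ^ (l + 1) → (cellNodes α : ℝ) ≤ 2 ^ l * 2 := fun h => by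
    rw [← pow_succ]
    exact_mod_cast (cellNodes_le_ceil hα).trans h.le
  have hx : (2 : ℝ) ≤ 2 ^ l := by simpa only [pow_one] using pow_le_pow_right₀ one_le_two hl
  generalize (cellNodes α : ℝ) = m at hm hm_le ⊢
  generalize (2 : ℝ) ^ l = x at hm_le hx ⊢
  have hx1 : 1 ≤ x := by linarith
  -- In the first case the denominator of `levelConf` contains enough powers of `m`; in the second
  -- one, `m ≤ ⌈α⌉ < 2 ^ (l + 1)` bounds the powers of `m` on the left by powers of `2 ^ l`.
  split_ifs with hlow
  · calc (m * x ^ 2) ^ d * x = m ^ d * x ^ (2 * d + 1) := by ring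
      _ ≤ m ^ (4 * (d + 2)) * x ^ (4 * (d + 2)) := by
        gcongr <;> first | assumption | omega
      _ = (m * x ^ (d + 2) * m ^ (d + 1)) ^ 4 := by ring
  · have hmx : m ≤ x ^ 2 := by nlinarith [hm_le (not_le.1 hlow)]
    calc (m * x ^ 2) ^ d * x ≤ (x ^ 2 * x ^ 2) ^ d * x := by gcongr
      _ = 1 * x ^ (4 * d + 1) := by ring
      _ ≤ m ^ 4 * x ^ (4 * (d + 2)) := by
        gcongr
        · exact one_le_pow₀ hm
        · omega
      _ = (m * x ^ (d + 2) * 1) ^ 4 := by ring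

theorem card_lineIndices_mul_levelConf_pow_le (hd : 1 ≤ d) (hδ : 0 < δ) (hδ1 : δ ≤ 1)
    (hα : 0 < α) (hl : 1 ≤ l) :
    (lineIndices d α l).card * levelConf d δ α l ^ 4 ≤ δ / 2 ^ l := by
  obtain ⟨d, rfl⟩ := Nat.exists_eq_add_of_le' hd
  have hm : (0 : ℝ) < cellNodes α := by exact_mod_cast one_le_cellNodes α
  have hdenom := pow_mul_two_pow_le_levelConf_denom d hα hl
  rw [card_lineIndices, Nat.add_sub_cancel, levelConf_eq_div, div_pow]
  push_cast
  generalize (cellNodes α * (2 ^ l) ^ (d + 2) *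
    if 2 ^ (l + 1) ≤ ⌈α⌉₊ then (cellNodes α : ℝ) ^ (d + 1) else 1) ^ 4 = D at hdenom ⊢
  have hD : 0 < D := lt_of_lt_of_le (by positivity) hdenom
  calc ((gridSize α l : ℝ) + 1) ^ d * (δ ^ 4 / D)
      ≤ (cellNodes α * (2 ^ l) ^ 2) ^ d * (δ / D) := by
        gcongr
        · exact gridSize_add_one_le α hl
        · exact pow_le_of_le_one hδ.le hδ1 (by norm_num)
    _ ≤ δ / 2 ^ l := by
        rw [← mul_div_assoc, div_le_div_iff₀ hD (by positivity)]
        calc (cellNodes α * (2 ^ l) ^ 2) ^ d * δ * 2 ^ l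
            = δ * ((cellNodes α * (2 ^ l) ^ 2) ^ d * 2 ^ l) := by ring
          _ ≤ δ * D := by gcongr

variable {Ω : Type*} [MeasurableSpace Ω] {μ : Measure Ω} {P : ClassificationProblem d}
  {Y : Request d → Point d → Ω → Bool}

theorem IsLabelOracle.measure_not_lineDeviation_le (hY : IsLabelOracle P μ Y)
    {a : Fin (d - 1) → ℕ} (ha : a ∈ lineIndices d α l) (hδ : 0 < δ) (hδ1 : δ ≤ 1) (K : ℕ) :
    μ {ω | ¬ LineDeviation (fun k j i z => Y ⟨l, a, k, j, i⟩ (gridPoint α l a, z) ω)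
        (fun z => P.eta (gridPoint α l a, z)) δ K} ≤ ENNReal.ofReal (δ ^ 4) := by
  have hmem : ∀ z ∈ Set.Icc (0 : ℝ) 1, (gridPoint α l a, z) ∈ cube d :=
    fun z hz => ⟨gridPoint_mem_baseCube α l ha, hz⟩
  refine ActiveLearning.measure_not_lineDeviation_le
    (Y := fun k j i z => Y ⟨l, a, k, j, i⟩ (gridPoint α l a, z))
    (fun k j i z => hY.measurable _ _) (fun k j z => ?_) (fun z hz => (P.eta_mem _ (hmem z hz)).1)
    (fun k j i z hz => hY.law _ _ (hmem z hz)) hδ hδ1 K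
  have hinj : Function.Injective fun i : ℕ => (⟨l, a, k, j, i⟩ : Request d) :=
    fun i i' h => congrArg Request.round h
  exact (hY.indep.precomp hinj).comp (fun _ f => f (gridPoint α l a, z))
    fun _ => measurable_pi_apply _

theorem IsLabelOracle.measure_not_allDeviation_le (hY : IsLabelOracle P μ Y) (hd : 1 ≤ d)
    (hδ : 0 < δ) (hδ1 : δ ≤ 1) (lam : ℝ) (hα : 0 < α) :
    μ {ω | ¬ AllDeviation P δ lam α (fun r x => Y r x ω)} ≤ ENNReal.ofReal δ := by
  have hcover : {ω | ¬ AllDeviation P δ lam α (fun r x => Y r x ω)} ⊆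
      ⋃ l : ℕ, ⋃ a ∈ lineIndices d α (l + 1), {ω | ¬ LineDeviation
        (fun k j i z => Y ⟨l + 1, a, k, j, i⟩ (gridPoint α (l + 1) a, z) ω)
        (fun z => P.eta (gridPoint α (l + 1) a, z)) (levelConf d δ α (l + 1))
        (numEpochs (precision lam α (l + 1)))} := by
    intro ω hω
    simp only [Set.mem_ofPred_eq, AllDeviation] at hω
    push Not at hω
    obtain ⟨l, hl, a, ha, h⟩ := hω
    obtain ⟨l, rfl⟩ := Nat.exists_eq_add_of_le' hl
    simp only [Set.mem_iUnion]
    exact ⟨l, a, ha, h⟩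
  have hlevel_le : ∀ l, levelConf d δ α l ≤ 1 := fun l =>
    ((levelConf_le_depthConf d hδ α l).trans (depthConf_le d hδ.le α l)).trans hδ1
  calc μ {ω | ¬ AllDeviation P δ lam α (fun r x => Y r x ω)}
      ≤ ∑' l : ℕ, ∑ _a ∈ lineIndices d α (l + 1),
          ENNReal.ofReal (levelConf d δ α (l + 1) ^ 4) := by
        refine (measure_mono hcover).trans <| (measure_iUnion_le _).trans <|
          ENNReal.tsum_le_tsum fun l => (measure_biUnion_finset_le _ _).trans <|
          Finset.sum_le_sum fun a ha => ?_
        exact hY.measure_not_lineDeviation_le ha (levelConf_pos d hδ α _) (hlevel_le _) _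
    _ ≤ ∑' l : ℕ, ENNReal.ofReal (δ / 2 / 2 ^ l) := by
        refine ENNReal.tsum_le_tsum fun l => ?_
        rw [Finset.sum_const, nsmul_eq_mul, ← ENNReal.ofReal_natCast,
          ← ENNReal.ofReal_mul (Nat.cast_nonneg _), div_div, ← pow_succ']
        exact ENNReal.ofReal_le_ofReal
          (card_lineIndices_mul_levelConf_pow_le hd hδ hδ1 hα l.succ_pos)
    _ = ENNReal.ofReal δ := by
        rw [← ENNReal.ofReal_tsum_of_nonneg (fun _ => by positivity) (summable_geometric_two' δ),
          tsum_geometric_two']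

end GoodEvent

/-! ### The cost of a line search -/

section LineCost

variable {κ c Λ lam α ε : ℝ} {l : ℕ}

theorem two_pow_numEpochs_mul_lt (hε : 0 < ε) (hK : 0 < numEpochs ε) :
    (2 : ℝ) ^ numEpochs ε * ε < 1 := by
  have hpos : 0 < Real.logb 2 (1 / (2 * ε)) := Nat.ceil_pos.1 hK
  have hlt : (numEpochs ε : ℝ) - 1 < Real.logb 2 (1 / (2 * ε)) :=
    sub_lt_iff_lt_add.2 (Nat.ceil_lt_add_one hpos.le)
  rw [Real.lt_logb_iff_rpow_lt one_lt_two (by positivity), Real.rpow_sub_one two_ne_zero,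
    Real.rpow_natCast, div_lt_div_iff₀ two_pos (by positivity)] at hlt
  linarith

theorem two_pow_numEpochs_precision_mul_lt (hlam : 0 < lam)
    (hK : 0 < numEpochs (precision lam α l)) :
    (2 : ℝ) ^ numEpochs (precision lam α l) * lam < ((2 : ℝ) ^ l) ^ α := by
  have h := two_pow_numEpochs_mul_lt (precision_pos hlam α l) hK
  generalize numEpochs (precision lam α l) = K at h ⊢
  rwa [precision_eq, ← mul_assoc, ← div_eq_mul_inv, div_lt_one (by positivity)] at h

/-- The margin `|η - 1/2|` is at least this at distance `2 ^ (-k) / 8` from the boundary. -/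
noncomputable def epochGap (κ c : ℝ) (k : ℕ) : ℝ := c * (((2 : ℝ) ^ k)⁻¹ / 8) ^ (κ - 1)

/-- Number of rounds that suffices in an epoch with margin `epochGap κ c k`, when `Λ` bounds the
logarithm in the confidence term. -/
noncomputable def epochRounds (κ c Λ : ℝ) (k : ℕ) : ℕ := ⌈8 * Λ / epochGap κ c k ^ 2⌉₊

/-- Bound on the number of labels of a line search with `K` epochs. -/
noncomputable def lineCost (κ c Λ : ℝ) (K : ℕ) : ℕ :=
  ∑ k ∈ Finset.range K, 3 * epochRounds κ c Λ k

theorem epochGap_pos (κ : ℝ) (hc : 0 < c) (k : ℕ) : 0 < epochGap κ c k := by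
  unfold epochGap
  positivity

theorem epochGap_le (hκ : 1 ≤ κ) (hc : 0 ≤ c) (k : ℕ) : epochGap κ c k ≤ c := by
  have hinv : ((2 : ℝ) ^ k)⁻¹ ≤ 1 := inv_le_one_of_one_le₀ (one_le_pow₀ one_le_two)
  exact mul_le_of_le_one_right hc
    (Real.rpow_le_one (by positivity) (by linarith) (by linarith))

theorem inv_epochGap_sq (κ c : ℝ) (k : ℕ) :
    (epochGap κ c k ^ 2)⁻¹ = (8 : ℝ) ^ (2 * (κ - 1)) / c ^ 2 * ((4 : ℝ) ^ (κ - 1)) ^ k := by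
  have hsq : ∀ x : ℝ, 0 ≤ x → (x ^ (κ - 1)) ^ 2 = (x ^ 2) ^ (κ - 1) := fun x hx =>
    (Real.rpow_pow_comm hx _ _)
  have hpow : ((4 : ℝ) ^ (κ - 1)) ^ k = (((2 : ℝ) ^ k) ^ 2) ^ (κ - 1) := by
    rw [Real.rpow_pow_comm (by norm_num), ← pow_mul, mul_comm, pow_mul]
    norm_num
  rw [epochGap, mul_pow, hsq _ (by positivity), div_pow, inv_pow, Real.div_rpow (by positivity)
    (by positivity), Real.inv_rpow (by positivity), hpow, Real.rpow_mul (by norm_num),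
    Real.rpow_two]
  field_simp

theorem epochRounds_le (hκ : 1 ≤ κ) (hc : 0 < c) (hc' : c ≤ 1 / 2) (hΛ : 1 ≤ Λ) (k : ℕ) :
    (epochRounds κ c Λ k : ℝ) ≤
      8.4 * Λ * ((8 : ℝ) ^ (2 * (κ - 1)) / c ^ 2 * ((4 : ℝ) ^ (κ - 1)) ^ k) := by
  have hgap := epochGap_pos κ hc k
  have hgap_sq : epochGap κ c k ^ 2 ≤ (1 / 2) ^ 2 :=
    pow_le_pow_left₀ hgap.le ((epochGap_le hκ hc.le k).trans hc') 2
  have hlarge : 32 ≤ 8 * Λ / epochGap κ c k ^ 2 := by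
    rw [le_div_iff₀ (by positivity)]
    linarith
  rw [← inv_epochGap_sq]
  calc (epochRounds κ c Λ k : ℝ) ≤ 8 * Λ / epochGap κ c k ^ 2 + 1 :=
        (Nat.ceil_lt_add_one (by linarith)).le
    _ ≤ 1.05 * (8 * Λ / epochGap κ c k ^ 2) := by linarith
    _ = 8.4 * Λ * (epochGap κ c k ^ 2)⁻¹ := by ring

theorem one_le_epochRounds (κ : ℝ) (hc : 0 < c) (hΛ : 0 < Λ) (k : ℕ) :
    1 ≤ epochRounds κ c Λ k := by
  have hgap := epochGap_pos κ hc k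
  exact Nat.ceil_pos.2 (by positivity)

theorem geom_sum_le_pow_div_log {a : ℝ} (ha : 1 < a) (K : ℕ) :
    ∑ k ∈ Finset.range K, a ^ k ≤ a ^ K / Real.log a := by
  have hlog : 0 < Real.log a := Real.log_pos ha
  rw [geom_sum_eq ha.ne']
  gcongr
  · exact sub_le_self _ zero_le_one
  · exact Real.log_le_sub_one_of_pos (by linarith)

theorem four_rpow_pow_numEpochs_le (hκ : 1 ≤ κ) (hlam : 0 < lam)
    (hK : 0 < numEpochs (precision lam α l)) :
    ((4 : ℝ) ^ (κ - 1)) ^ numEpochs (precision lam α l) ≤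
      lam ^ (-(2 * (κ - 1))) * ((2 : ℝ) ^ l) ^ (2 * α * (κ - 1)) := by
  have hlt := two_pow_numEpochs_precision_mul_lt hlam hK
  generalize numEpochs (precision lam α l) = K at hlt ⊢
  calc ((4 : ℝ) ^ (κ - 1)) ^ K = ((2 : ℝ) ^ K) ^ (2 * (κ - 1)) := by
        rw [Real.rpow_mul (by positivity), Real.rpow_two, ← pow_mul, mul_comm K, pow_mul,
          Real.rpow_pow_comm (by norm_num)]
        norm_num
    _ ≤ (((2 : ℝ) ^ l) ^ α / lam) ^ (2 * (κ - 1)) := by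
        gcongr
        exact (le_div_iff₀ hlam).2 hlt.le
    _ = lam ^ (-(2 * (κ - 1))) * ((2 : ℝ) ^ l) ^ (2 * α * (κ - 1)) := by
        rw [Real.div_rpow (by positivity) hlam.le, ← Real.rpow_mul (by positivity),
          Real.rpow_neg hlam.le, div_eq_inv_mul, mul_left_comm α, mul_assoc]

theorem lineCost_le (hκ : 1 < κ) (hc : 0 < c) (hc' : c ≤ 1 / 2) (hΛ : 1 ≤ Λ) (hlam : 0 < lam)
    (α : ℝ) (l : ℕ) :
    (lineCost κ c Λ (numEpochs (precision lam α l)) : ℝ) ≤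
      12.6 / Real.log 2 * Λ * ((8 : ℝ) ^ (2 * (κ - 1)) / (c ^ 2 * (κ - 1))) *
        (lam ^ (-(2 * (κ - 1))) * ((2 : ℝ) ^ l) ^ (2 * α * (κ - 1))) := by
  have : 0 < Real.log 2 := Real.log_pos one_lt_two
  have hs : 0 < κ - 1 := by linarith
  rcases Nat.eq_zero_or_pos (numEpochs (precision lam α l)) with hK | hK
  · rw [hK, lineCost, Finset.range_zero, Finset.sum_empty, Nat.cast_zero]
    positivity
  have hpow := four_rpow_pow_numEpochs_le hκ.le hlam hK
  generalize numEpochs (precision lam α l) = K at hpow ⊢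
  have hlog4 : Real.log ((4 : ℝ) ^ (κ - 1)) = 2 * (κ - 1) * Real.log 2 := by
    rw [Real.log_rpow (by norm_num), show (4 : ℝ) = 2 ^ 2 by norm_num, Real.log_pow]
    push_cast
    ring
  calc (lineCost κ c Λ K : ℝ) = ∑ k ∈ Finset.range K, 3 * (epochRounds κ c Λ k : ℝ) := by
        rw [lineCost]
        push_cast
        rfl
    _ ≤ ∑ k ∈ Finset.range K, 3 *
          (8.4 * Λ * ((8 : ℝ) ^ (2 * (κ - 1)) / c ^ 2 * ((4 : ℝ) ^ (κ - 1)) ^ k)) := by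
        gcongr with k
        exact epochRounds_le hκ.le hc hc' hΛ k
    _ = 25.2 * Λ * ((8 : ℝ) ^ (2 * (κ - 1)) / c ^ 2) *
          ∑ k ∈ Finset.range K, ((4 : ℝ) ^ (κ - 1)) ^ k := by
        rw [Finset.mul_sum]
        exact Finset.sum_congr rfl fun k _ => by ring
    _ ≤ 25.2 * Λ * ((8 : ℝ) ^ (2 * (κ - 1)) / c ^ 2) *
          (lam ^ (-(2 * (κ - 1))) * ((2 : ℝ) ^ l) ^ (2 * α * (κ - 1)) /
            (2 * (κ - 1) * Real.log 2)) := by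
        rw [← hlog4]
        have hone : 1 < (4 : ℝ) ^ (κ - 1) := Real.one_lt_rpow (by norm_num) hs
        have hlogpos := Real.log_pos hone
        gcongr
        refine (geom_sum_le_pow_div_log hone K).trans ?_
        gcongr
    _ = _ := by
        field_simp
        ring

end LineCost

/-! ### The total cost -/

section TotalCost

variable {d n : ℕ} {δ lam α κ c : ℝ} {l : ℕ}

/-- The exponent of the rate: up to constants and logarithms, depth `l` takes
`(2 ^ l) ^ rateExponent d α κ` labels. -/
noncomputable def rateExponent (d : ℕ) (α κ : ℝ) : ℝ := 2 * α * (κ - 1) + d - 1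

/-- The part of the cost of a depth that depends only on the dimension and the problem class; up
to `α`, `κ` and `log (1 / c)`, it is the reciprocal of `c₁ d α κ c`. -/
noncomputable def costFactor (d : ℕ) (α κ c : ℝ) : ℝ :=
  (2 * (⌈α⌉₊ : ℝ)) ^ (d - 1) * ((8 : ℝ) ^ (2 * (κ - 1)) / (c ^ 2 * (κ - 1)))

theorem costFactor_nonneg (d : ℕ) (α : ℝ) (hκ : 1 ≤ κ) (c : ℝ) : 0 ≤ costFactor d α κ c := by
  have := sub_nonneg.2 hκ
  unfold costFactor
  positivity

/-- Bound on the logarithm `log (t / δ')` of the confidence term, for every epoch of a depth that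
fits in the budget `n`. -/
noncomputable def logBound (n : ℕ) (δ α : ℝ) : ℝ := (3 + 2 * α) * Real.log (n / δ)

theorem log_two_le_log_div (hn : 1 ≤ n) (hδ : 0 < δ) (hδ' : δ ≤ 1 / 2) :
    Real.log 2 ≤ Real.log (n / δ) := by
  have hn' : (1 : ℝ) ≤ n := by exact_mod_cast hn
  refine Real.log_le_log two_pos ?_
  rw [le_div_iff₀ hδ]
  linarith

theorem one_le_logBound (hn : 1 ≤ n) (hδ : 0 < δ) (hδ' : δ ≤ 1 / 2) (hα : 0 ≤ α) :
    1 ≤ logBound n δ α := by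
  have hlog := (Real.log_two_gt_d9.trans_le (log_two_le_log_div hn hδ hδ')).le
  calc (1 : ℝ) ≤ 3 * 0.6931471803 := by norm_num
    _ ≤ (3 + 2 * α) * Real.log (n / δ) := by
      gcongr
      linarith

theorem c₁_nonneg (d : ℕ) (hα : 0 ≤ α) (hκ : 1 ≤ κ) (hc : 0 < c) (hc' : c ≤ 1) :
    0 ≤ c₁ d α κ c := by
  have hlog : 0 ≤ Real.log (1 / c) := Real.log_nonneg ((one_le_div hc).2 hc')
  have : 0 ≤ κ - 1 := sub_nonneg.2 hκ
  unfold c₁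
  positivity

theorem log_div_c₁_mul_nonneg (d : ℕ) (hn : 1 ≤ n) (hδ : 0 < δ) (hδ' : δ ≤ 1) (hα : 0 ≤ α)
    (hκ : 1 ≤ κ) (hc : 0 < c) (hc' : c ≤ 1) : 0 ≤ Real.log (n / δ) / (c₁ d α κ c * n) := by
  have hn' : (1 : ℝ) ≤ n := by exact_mod_cast hn
  have hc₁ := c₁_nonneg d hα hκ hc hc'
  have hlog : 0 ≤ Real.log (n / δ) := Real.log_nonneg ((one_le_div hδ).2 (hδ'.trans hn'))
  positivity

theorem widthBound_nonneg (d : ℕ) (hn : 1 ≤ n) (hδ : 0 < δ) (hδ' : δ ≤ 1) (hlam : 0 ≤ lam)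
    (hα : 0 ≤ α) (hκ : 1 ≤ κ) (hc : 0 < c) (hc' : c ≤ 1) : 0 ≤ widthBound d n δ lam α κ c := by
  have hX := log_div_c₁_mul_nonneg d hn hδ hδ' hα hκ hc hc'
  unfold widthBound
  positivity

theorem log_div_c₁_mul_eq (d n : ℕ) (δ α κ c : ℝ) :
    Real.log (n / δ) / (c₁ d α κ c * n) =
      400 * α * (Real.log (1 / c) * κ) * (Real.log (n / δ) * costFactor d α κ c) / n := by
  rw [c₁, costFactor]
  generalize κ - 1 = s
  rw [div_mul_eq_mul_div, div_div_eq_mul_div]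
  ring

theorem one_le_rateExponent (hd : 2 ≤ d) (hα : 0 ≤ α) (hκ : 1 ≤ κ) : 1 ≤ rateExponent d α κ := by
  have hd' : (2 : ℝ) ≤ d := by exact_mod_cast hd
  have hs : 0 ≤ 2 * α * (κ - 1) := mul_nonneg (by positivity) (sub_nonneg.2 hκ)
  rw [rateExponent]
  linarith

theorem sum_range_pow_succ_le {x : ℝ} (hx : 2 ≤ x) (L : ℕ) :
    ∑ l ∈ Finset.range L, x ^ (l + 1) ≤ 2 * x ^ L := by
  induction L with
  | zero => norm_num
  | succ L ih =>
    rw [Finset.sum_range_succ]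
    have hstep : 2 * x ^ L ≤ x ^ (L + 1) := by
      rw [pow_succ']
      gcongr
    linarith

theorem sum_two_pow_rpow_le {A : ℝ} (hA : 1 ≤ A) (L : ℕ) :
    ∑ l ∈ Finset.range L, ((2 : ℝ) ^ (l + 1)) ^ A ≤ 2 * ((2 : ℝ) ^ L) ^ A := by
  simp only [← Real.rpow_pow_comm (zero_le_two (α := ℝ))]
  exact sum_range_pow_succ_le (by simpa only [Real.rpow_one] using
    Real.rpow_le_rpow_of_exponent_le one_le_two hA) L

theorem two_pow_rpow_rateExponent (hd : 1 ≤ d) (α κ : ℝ) (l : ℕ) :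
    ((2 : ℝ) ^ l) ^ rateExponent d α κ =
      ((2 : ℝ) ^ l) ^ (d - 1) * ((2 : ℝ) ^ l) ^ (2 * α * (κ - 1)) := by
  rw [← Real.rpow_natCast _ (d - 1), ← Real.rpow_add (by positivity), Nat.cast_sub hd,
    Nat.cast_one, rateExponent]
  ring_nf

theorem gridSize_add_one_pow_le (hd : 2 ≤ d) (hα : 0 < α) (hl : 1 ≤ l) :
    ((gridSize α l : ℝ) + 1) ^ (d - 1) ≤
      0.75 * ((2 * (⌈α⌉₊ : ℝ)) ^ (d - 1) * ((2 : ℝ) ^ l) ^ (d - 1)) := by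
  have hm : (cellNodes α : ℝ) ≤ ⌈α⌉₊ := by exact_mod_cast cellNodes_le_ceil hα
  have hceil : (1 : ℝ) ≤ ⌈α⌉₊ := by exact_mod_cast Nat.ceil_pos.2 hα
  have htwo : (2 : ℝ) ≤ 2 ^ l := le_self_pow₀ one_le_two (by omega)
  have hbase : (gridSize α l : ℝ) + 1 ≤ 0.75 * (2 * (⌈α⌉₊ : ℝ) * 2 ^ l) := by
    rw [gridSize]
    push_cast
    nlinarith
  calc ((gridSize α l : ℝ) + 1) ^ (d - 1)
      ≤ (0.75 * (2 * (⌈α⌉₊ : ℝ) * 2 ^ l)) ^ (d - 1) := by gcongr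
    _ = 0.75 ^ (d - 1) * ((2 * (⌈α⌉₊ : ℝ)) ^ (d - 1) * ((2 : ℝ) ^ l) ^ (d - 1)) := by
      rw [mul_pow, mul_pow (2 * (⌈α⌉₊ : ℝ))]
    _ ≤ _ := by
      gcongr
      exact pow_le_of_le_one (by norm_num) (by norm_num) (by omega)

theorem levelCost_le (hd : 2 ≤ d) {Λ : ℝ} (hΛ : 1 ≤ Λ) (hlam : 0 < lam) (hα : 0 < α)
    (hκ : 1 < κ) (hc : 0 < c) (hc' : c ≤ 1 / 2) (hl : 1 ≤ l) :
    ((gridSize α l : ℝ) + 1) ^ (d - 1) * lineCost κ c Λ (numEpochs (precision lam α l)) ≤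
      9.45 / Real.log 2 * (Λ * costFactor d α κ c * lam ^ (-(2 * (κ - 1)))) *
        ((2 : ℝ) ^ l) ^ rateExponent d α κ := by
  refine (mul_le_mul (gridSize_add_one_pow_le hd hα hl) (lineCost_le hκ hc hc' hΛ hlam α l)
    (Nat.cast_nonneg _) (by positivity)).trans_eq ?_
  rw [two_pow_rpow_rateExponent (by omega), costFactor]
  ring

theorem totalCost_le (hd : 2 ≤ d) {Λ : ℝ} (hΛ : 1 ≤ Λ) (hlam : 0 < lam) (hα : 0 < α)
    (hκ : 1 < κ) (hc : 0 < c) (hc' : c ≤ 1 / 2) (L : ℕ) :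
    ((∑ l ∈ Finset.range L, (gridSize α (l + 1) + 1) ^ (d - 1) *
      lineCost κ c Λ (numEpochs (precision lam α (l + 1))) : ℕ) : ℝ) ≤
      18.9 / Real.log 2 * (Λ * costFactor d α κ c *
        (((2 : ℝ) ^ L) ^ rateExponent d α κ * lam ^ (-(2 * (κ - 1))))) := by
  have : 0 < κ - 1 := sub_pos.2 hκ
  have : 0 < Real.log 2 := Real.log_pos one_lt_two
  have hQ := costFactor_nonneg d α hκ.le c
  push_cast
  calc _ ≤ ∑ l ∈ Finset.range L, 9.45 / Real.log 2 *
          (Λ * costFactor d α κ c * lam ^ (-(2 * (κ - 1)))) *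
          ((2 : ℝ) ^ (l + 1)) ^ rateExponent d α κ :=
        Finset.sum_le_sum fun l _ => levelCost_le hd hΛ hlam hα hκ hc hc' l.succ_pos
    _ ≤ 9.45 / Real.log 2 * (Λ * costFactor d α κ c * lam ^ (-(2 * (κ - 1)))) *
          (2 * ((2 : ℝ) ^ L) ^ rateExponent d α κ) := by
        rw [← Finset.mul_sum]
        gcongr
        exact sum_two_pow_rpow_le (one_le_rateExponent hd hα.le hκ.le) L
    _ = _ := by ring

theorem three_mul_add_two_mul_rpow_le {u : ℝ} (hu : 0 ≤ u) :
    (3 * u + 2) * (6 / 7 : ℝ) ^ u ≤ 10 := by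
  have hexp : (6 / 7 : ℝ) ^ u ≤ (Real.exp (u / 7))⁻¹ := by
    calc (6 / 7 : ℝ) ^ u ≤ Real.exp (-(1 / 7)) ^ u := by
          gcongr
          linarith [Real.one_sub_le_exp_neg (1 / 7)]
      _ = (Real.exp (u / 7))⁻¹ := by
          rw [← Real.exp_mul, ← Real.exp_neg]
          ring_nf
  have hquad : 3 * u + 2 ≤ 10 * Real.exp (u / 7) := by
    have := Real.quadratic_le_exp_of_nonneg (show 0 ≤ u / 7 by positivity)
    nlinarith [sq_nonneg (u / 7 - 1)]
  calc (3 * u + 2) * (6 / 7 : ℝ) ^ u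
      ≤ 10 * Real.exp (u / 7) * (Real.exp (u / 7))⁻¹ := by gcongr
    _ = 10 := by field_simp

theorem log_div_c₁_rpow_mul_le {F : ℕ} (hlam : 0 < lam) (hα : 0 < α)
    (hF : widthBound d n δ lam α κ c < 6 * bias d lam α F) :
    (Real.log (n / δ) / (c₁ d α κ c * n)) ^ (α / rateExponent d α κ) *
      (((2 : ℝ) ^ (F + 1)) ^ α * lam ^ (((d : ℝ) - 1) / rateExponent d α κ - 1)) ≤ 6 / 7 := by
  have hceil : (0 : ℝ) < ⌈α⌉₊ := by exact_mod_cast Nat.ceil_pos.2 hα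
  have hm : (1 : ℝ) ≤ cellNodes α := by exact_mod_cast one_le_cellNodes α
  have hgrid : (gridSize α F : ℝ) ^ (-α) ≤ ((2 : ℝ) ^ F) ^ (-α) := by
    refine Real.rpow_le_rpow_of_nonpos (by positivity) ?_ (by linarith)
    rw [gridSize]
    push_cast
    exact le_mul_of_one_le_left (by positivity) hm
  rw [widthBound, bias, ← rateExponent] at hF
  generalize (Real.log (n / δ) / (c₁ d α κ c * n)) ^ (α / rateExponent d α κ) = X at hF ⊢
  generalize ((d : ℝ) - 1) / rateExponent d α κ = p at hF ⊢
  set q : ℝ := (⌈α⌉₊ : ℝ) ^ (d * ⌈α⌉₊)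
  have hwidth : 7 * 2 ^ α * lam ^ p * X < 6 * lam * ((2 : ℝ) ^ F) ^ (-α) := by
    refine lt_of_mul_lt_mul_left (a := q) ?_ (by positivity)
    calc q * (7 * 2 ^ α * lam ^ p * X) = 7 * q * 2 ^ α * lam ^ p * X := by ring
      _ < 6 * (lam * q * (gridSize α F : ℝ) ^ (-α)) := hF
      _ ≤ 6 * (lam * q * ((2 : ℝ) ^ F) ^ (-α)) := by gcongr
      _ = q * (6 * lam * ((2 : ℝ) ^ F) ^ (-α)) := by ring
  rw [Real.rpow_neg (by positivity), ← div_eq_mul_inv, lt_div_iff₀ (by positivity)] at hwidth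
  rw [Real.rpow_sub_one hlam.ne', pow_succ', Real.mul_rpow zero_le_two (by positivity),
    ← mul_div_assoc, ← mul_div_assoc, div_le_div_iff₀ hlam (by norm_num)]
  linarith

theorem log_div_c₁_mul_two_pow_rpow_le {F : ℕ} (hd : 2 ≤ d) (hn : 1 ≤ n) (hδ : 0 < δ)
    (hδ' : δ ≤ 1) (hlam : 0 < lam) (hα : 0 < α) (hκ : 1 ≤ κ) (hc : 0 < c) (hc' : c ≤ 1)
    (hF : widthBound d n δ lam α κ c < 6 * bias d lam α F) :
    Real.log (n / δ) / (c₁ d α κ c * n) *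
      (((2 : ℝ) ^ (F + 1)) ^ rateExponent d α κ * lam ^ (-(2 * (κ - 1)))) ≤
      (6 / 7 : ℝ) ^ (1 / α) := by
  have hX := log_div_c₁_mul_nonneg d hn hδ hδ' hα.le hκ hc hc'
  have hA := one_le_rateExponent hd hα.le hκ
  have hA₀ : 0 < rateExponent d α κ := by linarith
  have hbase := log_div_c₁_rpow_mul_le hlam hα hF
  have hlamExp : (((d : ℝ) - 1) / rateExponent d α κ - 1) * (rateExponent d α κ / α) =
      -(2 * (κ - 1)) := by
    field_simp
    rw [rateExponent]
    ring
  have hpow := Real.rpow_le_rpow (by positivity) hbase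
    (show 0 ≤ rateExponent d α κ / α by positivity)
  rw [Real.mul_rpow (by positivity) (by positivity), Real.mul_rpow (by positivity) (by positivity),
    ← Real.rpow_mul hX, ← Real.rpow_mul (by positivity), ← Real.rpow_mul hlam.le, hlamExp,
    div_mul_div_cancel₀ hA₀.ne', div_self hα.ne', Real.rpow_one, mul_div_cancel₀ _ hα.ne'] at hpow
  exact hpow.trans (Real.rpow_le_rpow_of_exponent_ge (by norm_num) (by norm_num) (by gcongr))

theorem log_two_le_log_inv_mul (hc : 0 < c) (hc' : c ≤ 1 / 2) (hκ : 1 ≤ κ) :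
    Real.log 2 ≤ Real.log (1 / c) * κ := by
  have h : Real.log 2 ≤ Real.log (1 / c) :=
    Real.log_le_log two_pos ((le_div_iff₀ hc).2 (by linarith))
  exact h.trans (le_mul_of_one_le_right ((Real.log_pos one_lt_two).le.trans h) hκ)

theorem totalCost_lt {F : ℕ} (hd : 2 ≤ d) (hn : 1 ≤ n) (hδ : 0 < δ) (hδ' : δ ≤ 1 / 2)
    (hlam : 0 < lam) (hα : 0 < α) (hκ : 1 < κ) (hc : 0 < c) (hc' : c ≤ 1 / 2)
    (hF : widthBound d n δ lam α κ c < 6 * bias d lam α F) :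
    ∑ l ∈ Finset.range (F + 1), (gridSize α (l + 1) + 1) ^ (d - 1) *
      lineCost κ c (logBound n δ α) (numEpochs (precision lam α (l + 1))) < n := by
  have hn' : (0 : ℝ) < n := by exact_mod_cast hn
  have : 0 < κ - 1 := sub_pos.2 hκ
  have hlog2 : 0.6931 < Real.log 2 := by linarith [Real.log_two_gt_d9]
  have hlogc := log_two_le_log_inv_mul hc hc' hκ.le
  have hlogn : 0 < Real.log (n / δ) :=
    (Real.log_pos one_lt_two).trans_le (log_two_le_log_div hn hδ hδ')
  have hrate := log_div_c₁_mul_two_pow_rpow_le hd hn hδ (by linarith) hlam hα hκ.le hc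
    (by linarith) hF
  have hcost := totalCost_le hd (one_le_logBound hn hδ hδ' hα.le) hlam hα hκ hc hc' (F + 1)
  have hQ := costFactor_nonneg d α hκ.le c
  rw [log_div_c₁_mul_eq, div_mul_eq_mul_div, div_le_iff₀ hn', mul_assoc] at hrate
  set Z : ℝ := ((2 : ℝ) ^ (F + 1)) ^ rateExponent d α κ * lam ^ (-(2 * (κ - 1)))
  set G : ℝ := Real.log (n / δ) * costFactor d α κ c * Z with hG
  have : 0 ≤ G := by positivity
  have hbudget : 400 * Real.log 2 * ((3 + 2 * α) * G) ≤ 10 * n := by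
    calc 400 * Real.log 2 * ((3 + 2 * α) * G)
        = (3 * (1 / α) + 2) * (400 * α * Real.log 2 * G) := by field_simp
      _ ≤ (3 * (1 / α) + 2) * (400 * α * (Real.log (1 / c) * κ) * G) := by gcongr
      _ ≤ (3 * (1 / α) + 2) * ((6 / 7 : ℝ) ^ (1 / α) * n) := by gcongr
      _ = (3 * (1 / α) + 2) * (6 / 7 : ℝ) ^ (1 / α) * n := by ring
      _ ≤ 10 * n := by
        gcongr
        exact three_mul_add_two_mul_rpow_le (by positivity)
  rw [← Nat.cast_lt (α := ℝ)]
  calc _ ≤ 18.9 / Real.log 2 * (logBound n δ α * costFactor d α κ c * Z) := hcost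
    _ = 18.9 * ((3 + 2 * α) * G) / Real.log 2 := by
      rw [logBound, hG]
      ring
    _ < n := by
      have hsq : 0.48 < Real.log 2 * Real.log 2 := by nlinarith
      rw [div_lt_iff₀ (by linarith)]
      refine lt_of_mul_lt_mul_left (a := 400 * Real.log 2) ?_ (by positivity)
      calc 400 * Real.log 2 * (18.9 * ((3 + 2 * α) * G)) ≤ 18.9 * (10 * n) := by linarith
        _ < 400 * (0.48 * n) := by linarith
        _ ≤ 400 * (Real.log 2 * Real.log 2 * n) := by gcongr
        _ = 400 * Real.log 2 * (n * Real.log 2) := by ring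

end TotalCost

/-! ### Confidence within the budget -/

section Confidence

variable {d n : ℕ} {δ lam α κ c Λ : ℝ} {l k : ℕ}

theorem two_mul_conf_le {gap : ℝ} {t : ℕ} (hgap : 0 < gap) (hlog : Real.log (t / δ) ≤ Λ)
    (ht : 8 * Λ / gap ^ 2 ≤ t) : 2 * conf δ t ≤ gap := by
  have hsqrt : Real.sqrt (Real.log (t / δ) / (2 * t)) ≤ gap / 4 := by
    refine Real.sqrt_le_iff.2 ⟨by positivity, div_le_of_le_mul₀ (by positivity) (by positivity) ?_⟩
    rw [div_le_iff₀ (by positivity)] at ht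
    linarith
  rw [conf]
  linarith

theorem gridSize_pow_mul_epochRounds_le {K : ℕ} (hk : k < K)
    (hcost : (gridSize α l + 1) ^ (d - 1) * lineCost κ c Λ K ≤ n) :
    gridSize α l ^ (d - 1) * epochRounds κ c Λ k ≤ n := by
  have hrounds : 3 * epochRounds κ c Λ k ≤ lineCost κ c Λ K :=
    Finset.single_le_sum (f := fun k => 3 * epochRounds κ c Λ k) (fun _ _ => Nat.zero_le _)
      (Finset.mem_range.2 hk)
  refine le_trans (Nat.mul_le_mul (Nat.pow_le_pow_left (Nat.le_succ _) _) ?_) hcost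
  omega

theorem numEpochs_mul_two_pow_le (hlam : 1 ≤ lam) (hα : 0 ≤ α)
    (hK : 0 < numEpochs (precision lam α l)) (hn : gridSize α l ≤ n) :
    (numEpochs (precision lam α l) : ℝ) * 2 ^ numEpochs (precision lam α l) ≤
      (n : ℝ) ^ (2 * α) := by
  have hlt := two_pow_numEpochs_precision_mul_lt (by linarith) hK
  generalize numEpochs (precision lam α l) = K at hlt ⊢
  have htwo : (2 : ℝ) ^ l ≤ n := by
    exact_mod_cast (Nat.le_mul_of_pos_left _ (one_le_cellNodes α)).trans hn
  have hpow : (2 : ℝ) ^ K ≤ (n : ℝ) ^ α := by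
    calc (2 : ℝ) ^ K ≤ 2 ^ K * lam := le_mul_of_one_le_right (by positivity) hlam
      _ ≤ ((2 : ℝ) ^ l) ^ α := hlt.le
      _ ≤ (n : ℝ) ^ α := by gcongr
  have hself : (K : ℝ) ≤ 2 ^ K := by exact_mod_cast Nat.lt_two_pow_self.le
  calc (K : ℝ) * 2 ^ K ≤ (n : ℝ) ^ α * (n : ℝ) ^ α := by
        gcongr
        exact hself.trans hpow
    _ = (n : ℝ) ^ (2 * α) := by
        rw [two_mul, Real.rpow_add (lt_of_lt_of_le (by positivity) htwo)]

theorem div_gridSize_pow_le_levelConf (d : ℕ) (hδ : 0 < δ) (α : ℝ) (l : ℕ) :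
    δ / (gridSize α l : ℝ) ^ (d + 1) ≤ levelConf d δ α l := by
  refine (depthConf_div_le_levelConf d hδ α l).trans_eq' ?_
  rw [depthConf, gridSize, div_div]
  push_cast
  rw [mul_pow, ← pow_mul, pow_succ (cellNodes α : ℝ)]
  ring

theorem div_levelConf_div_le {K t : ℕ} (hd : 1 ≤ d) (hδ : 0 < δ) (hδ' : δ ≤ 1) (hα : 0 ≤ α)
    (hk : k < K) (hK : (K : ℝ) * 2 ^ K ≤ (n : ℝ) ^ (2 * α)) (hgrid : gridSize α l ≤ n)
    (ht : gridSize α l ^ (d - 1) * t ≤ n) :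
    (t : ℝ) / (levelConf d δ α l / (K * 2 ^ (k + 1))) ≤ (n / δ) ^ (3 + 2 * α) := by
  have hM : (0 : ℝ) < gridSize α l := by exact_mod_cast gridSize_pos α l
  have hn : (0 : ℝ) < n := hM.trans_le (by exact_mod_cast hgrid)
  have hK₀ : (0 : ℝ) < K := by exact_mod_cast (Nat.zero_le k).trans_lt hk
  have ht' : (gridSize α l : ℝ) ^ (d - 1) * t ≤ n := by exact_mod_cast ht
  have hconf : δ / ((gridSize α l : ℝ) ^ (d + 1) * (K * 2 ^ K)) ≤
      levelConf d δ α l / (K * 2 ^ (k + 1)) := by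
    rw [← div_div]
    gcongr
    · exact (levelConf_pos d hδ α l).le
    · exact div_gridSize_pow_le_levelConf d hδ α l
    · exact one_le_two
    · exact hk
  have hδpow : δ ^ (3 + 2 * α) ≤ δ := by
    simpa only [Real.rpow_one] using
      Real.rpow_le_rpow_of_exponent_ge hδ hδ' (by linarith : (1 : ℝ) ≤ 3 + 2 * α)
  calc (t : ℝ) / (levelConf d δ α l / (K * 2 ^ (k + 1)))
      ≤ t / (δ / ((gridSize α l : ℝ) ^ (d + 1) * (K * 2 ^ K))) := by gcongr
    _ = (gridSize α l : ℝ) ^ (d - 1) * t * (gridSize α l : ℝ) ^ 2 * (K * 2 ^ K) / δ := by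
      rw [show d + 1 = d - 1 + 2 by omega, pow_add, div_div_eq_mul_div]
      ring
    _ ≤ n * (n : ℝ) ^ 2 * (n : ℝ) ^ (2 * α) / δ := by gcongr
    _ = (n : ℝ) ^ (3 + 2 * α) / δ := by
      rw [Real.rpow_add hn, ← pow_succ', ← Real.rpow_natCast]
      norm_num
    _ ≤ (n : ℝ) ^ (3 + 2 * α) / δ ^ (3 + 2 * α) := by gcongr
    _ = (n / δ) ^ (3 + 2 * α) := (Real.div_rpow hn.le hδ.le _).symm

theorem two_mul_conf_le_epochGap (hd : 2 ≤ d) (hn : 1 ≤ n) (hδ : 0 < δ) (hδ' : δ ≤ 1 / 2)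
    (hlam : 1 ≤ lam) (hα : 0 < α) (hc : 0 < c) (hk : k < numEpochs (precision lam α l))
    (hcost : (gridSize α l + 1) ^ (d - 1) *
      lineCost κ c (logBound n δ α) (numEpochs (precision lam α l)) ≤ n) :
    2 * conf (levelConf d δ α l / (numEpochs (precision lam α l) * 2 ^ (k + 1)))
      (epochRounds κ c (logBound n δ α) k) ≤ epochGap κ c k := by
  have hK := (Nat.zero_le k).trans_lt hk
  have hrounds := one_le_epochRounds κ hc
    (zero_lt_one.trans_le (one_le_logBound hn hδ hδ' hα.le)) k
  have hmul := gridSize_pow_mul_epochRounds_le hk hcost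
  have hgrid : gridSize α l ≤ n :=
    ((Nat.le_self_pow (by omega) _).trans (Nat.le_mul_of_pos_right _ hrounds)).trans hmul
  have hratio := div_levelConf_div_le (by omega) hδ (by linarith) hα.le hk
    (numEpochs_mul_two_pow_le hlam hα.le hK hgrid) hgrid hmul
  refine two_mul_conf_le (Λ := logBound n δ α) (epochGap_pos κ hc k) ?_ (Nat.le_ceil _)
  have hlevel := levelConf_pos d hδ α l
  calc Real.log _ ≤ Real.log ((n / δ) ^ (3 + 2 * α)) := Real.log_le_log (by positivity) hratio
    _ = logBound n δ α := Real.log_rpow (by positivity) _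

end Confidence

/-! ### The bias term -/

section Bias

variable {d l : ℕ} {lam α : ℝ}

theorem bias_eq (d : ℕ) (lam α : ℝ) (l : ℕ) : bias d lam α l =
    lam * (⌈α⌉₊ : ℝ) ^ (d * ⌈α⌉₊) / ((cellNodes α : ℝ) * 2 ^ l) ^ α := by
  rw [bias, Real.rpow_neg (Nat.cast_nonneg _), gridSize, div_eq_mul_inv, Nat.cast_mul,
    Nat.cast_pow, Nat.cast_two]

theorem bias_pos (d : ℕ) (hlam : 0 < lam) (hα : 0 < α) (l : ℕ) : 0 < bias d lam α l := by
  have : (0 : ℝ) < ⌈α⌉₊ := by exact_mod_cast Nat.ceil_pos.2 hα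
  have hM : (0 : ℝ) < gridSize α l := by exact_mod_cast gridSize_pos α l
  unfold bias
  positivity

theorem cellNodes_rpow_le (hα : 0 < α) : (cellNodes α : ℝ) ^ α ≤ (⌈α⌉₊ : ℝ) ^ ⌈α⌉₊ := by
  have hm : (cellNodes α : ℝ) ≤ ⌈α⌉₊ := by exact_mod_cast cellNodes_le_ceil hα
  have hceil : (1 : ℝ) ≤ ⌈α⌉₊ := by exact_mod_cast Nat.ceil_pos.2 hα
  calc (cellNodes α : ℝ) ^ α ≤ (⌈α⌉₊ : ℝ) ^ α := by gcongr
    _ ≤ (⌈α⌉₊ : ℝ) ^ (⌈α⌉₊ : ℝ) := Real.rpow_le_rpow_of_exponent_le hceil (Nat.le_ceil α)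
    _ = (⌈α⌉₊ : ℝ) ^ ⌈α⌉₊ := Real.rpow_natCast _ _

theorem two_pow_strictFloor_le (hα : 0 < α) : 2 ^ strictFloor α ≤ ⌈α⌉₊ ^ ⌈α⌉₊ := by
  have hceil := Nat.ceil_pos.2 hα
  rcases Nat.eq_zero_or_pos (strictFloor α) with h | h
  · rw [h, pow_zero]
    exact Nat.one_le_pow _ _ hceil
  · rw [strictFloor] at h ⊢
    exact (Nat.pow_le_pow_left (by omega) _).trans (Nat.pow_le_pow_right hceil (Nat.sub_le _ _))

theorem two_pow_mul_cellNodes_rpow_le (hd : 1 ≤ d) (hα : 0 < α) :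
    (2 : ℝ) ^ (strictFloor α * (d - 1)) * (cellNodes α : ℝ) ^ α ≤
      (⌈α⌉₊ : ℝ) ^ (d * ⌈α⌉₊) := by
  have hpow : (2 : ℝ) ^ strictFloor α ≤ (⌈α⌉₊ : ℝ) ^ ⌈α⌉₊ := by
    exact_mod_cast two_pow_strictFloor_le hα
  calc (2 : ℝ) ^ (strictFloor α * (d - 1)) * (cellNodes α : ℝ) ^ α
      ≤ ((⌈α⌉₊ : ℝ) ^ ⌈α⌉₊) ^ (d - 1) * (⌈α⌉₊ : ℝ) ^ ⌈α⌉₊ := by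
        rw [pow_mul]
        gcongr
        exact cellNodes_rpow_le hα
    _ = (⌈α⌉₊ : ℝ) ^ (d * ⌈α⌉₊) := by
        rw [← pow_succ, Nat.sub_add_cancel hd, ← pow_mul, mul_comm]

theorem two_pow_mul_precision_add_le (hd : 1 ≤ d) (hlam : 0 ≤ lam) (hα : 0 < α) (l : ℕ) :
    (2 : ℝ) ^ (strictFloor α * (d - 1)) * (precision lam α l + lam * (((2 : ℝ) ^ l)⁻¹) ^ α) ≤
      2 * bias d lam α l := by
  have hm : (0 : ℝ) < cellNodes α := by exact_mod_cast one_le_cellNodes α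
  have hpow := two_pow_mul_cellNodes_rpow_le hd hα
  rw [precision_eq, bias_eq, Real.inv_rpow (by positivity), Real.mul_rpow hm.le (by positivity)]
  have : (0 : ℝ) < (cellNodes α : ℝ) ^ α := by positivity
  have : (0 : ℝ) < ((2 : ℝ) ^ l) ^ α := by positivity
  calc (2 : ℝ) ^ (strictFloor α * (d - 1)) *
        (lam * (((2 : ℝ) ^ l) ^ α)⁻¹ + lam * (((2 : ℝ) ^ l) ^ α)⁻¹)
      = 2 * (lam * ((2 : ℝ) ^ (strictFloor α * (d - 1)) * (cellNodes α : ℝ) ^ α) /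
          ((cellNodes α : ℝ) ^ α * ((2 : ℝ) ^ l) ^ α)) := by
        field_simp
        ring
    _ ≤ _ := by gcongr

theorem two_pow_mul_gridSize_le (hd : 2 ≤ d) (hα : 0 < α) (hl : 2 ^ (l + 1) ≤ ⌈α⌉₊) :
    2 ^ (d - 1) * gridSize α l ≤ ⌈α⌉₊ ^ d := by
  obtain ⟨e, rfl⟩ := Nat.exists_eq_add_of_le' hd
  have htwo : 2 ≤ ⌈α⌉₊ := (Nat.le_self_pow l.succ_ne_zero 2).trans hl
  calc 2 ^ (e + 1) * gridSize α l = 2 ^ e * (cellNodes α * 2 ^ (l + 1)) := by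
        rw [gridSize]
        ring
    _ ≤ ⌈α⌉₊ ^ e * (⌈α⌉₊ * ⌈α⌉₊) :=
        Nat.mul_le_mul (Nat.pow_le_pow_left htwo e) (Nat.mul_le_mul (cellNodes_le_ceil hα) hl)
    _ = ⌈α⌉₊ ^ (e + 2) := by ring

theorem two_pow_strictFloor_mul_le_bias (hd : 2 ≤ d) (hlam : 1 ≤ lam) (hα : 0 < α)
    (hl : 2 ^ (l + 1) ≤ ⌈α⌉₊) : (2 : ℝ) ^ (strictFloor α * (d - 1)) ≤ bias d lam α l := by
  have hM : (1 : ℝ) ≤ gridSize α l := by exact_mod_cast gridSize_pos α l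
  have hgrid : (2 : ℝ) ^ (d - 1) * gridSize α l ≤ (⌈α⌉₊ : ℝ) ^ d := by
    exact_mod_cast two_pow_mul_gridSize_le hd hα hl
  rw [bias, Real.rpow_neg (by positivity), ← div_eq_mul_inv, le_div_iff₀ (by positivity)]
  calc (2 : ℝ) ^ (strictFloor α * (d - 1)) * (gridSize α l : ℝ) ^ α
      ≤ (2 : ℝ) ^ (⌈α⌉₊ * (d - 1)) * (gridSize α l : ℝ) ^ ⌈α⌉₊ := by
        gcongr
        · exact one_le_two
        · exact Nat.sub_le _ _
        · rw [← Real.rpow_natCast]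
          exact Real.rpow_le_rpow_of_exponent_le hM (Nat.le_ceil α)
    _ = ((2 : ℝ) ^ (d - 1) * gridSize α l) ^ ⌈α⌉₊ := by
        rw [mul_pow, ← pow_mul, mul_comm (d - 1)]
    _ ≤ ((⌈α⌉₊ : ℝ) ^ d) ^ ⌈α⌉₊ := by gcongr
    _ ≤ lam * (⌈α⌉₊ : ℝ) ^ (d * ⌈α⌉₊) := by
        rw [← pow_mul]
        exact le_mul_of_one_le_left (by positivity) hlam

theorem one_le_bias_zero (hd : 1 ≤ d) (hlam : 1 ≤ lam) (hα : 0 < α) : 1 ≤ bias d lam α 0 := by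
  have hm : (1 : ℝ) ≤ cellNodes α := by exact_mod_cast one_le_cellNodes α
  have hmα : (0 : ℝ) < (cellNodes α : ℝ) ^ α := by positivity
  rw [bias_eq, pow_zero, mul_one, one_le_div hmα]
  calc (cellNodes α : ℝ) ^ α ≤ (2 : ℝ) ^ (strictFloor α * (d - 1)) * (cellNodes α : ℝ) ^ α :=
        le_mul_of_one_le_left hmα.le (one_le_pow₀ one_le_two)
    _ ≤ (⌈α⌉₊ : ℝ) ^ (d * ⌈α⌉₊) := two_pow_mul_cellNodes_rpow_le hd hα
    _ ≤ lam * (⌈α⌉₊ : ℝ) ^ (d * ⌈α⌉₊) := le_mul_of_one_le_left (by positivity) hlam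

end Bias

/-! ### Correctness on the good event -/

section Correctness

variable {d n l : ℕ} {lam α κ c δ Δ : ℝ} {P : ClassificationProblem d}
  {g : (Fin (d - 1) → ℝ) → ℝ} {y : Request d → Point d → Bool} {x : Fin (d - 1) → ℝ}

theorem InClass.isThreshold (hP : InClass P lam α κ c g) (hx : x ∈ baseCube d) :
    IsThreshold (fun z => P.eta (x, z)) (g x) := fun z hz =>
  have hcube : (x, z) ∈ cube d := ⟨hx, hz⟩
  (and_iff_right hcube).symm.trans ((Set.ext_iff.1 hP.epigraph (x, z)).trans (and_iff_right hcube))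

theorem InClass.epochGap_le_abs_sub (hP : InClass P lam α κ c g) (hκ : 1 ≤ κ) (hc : 0 ≤ c)
    (hx : x ∈ baseCube d) {k : ℕ} {z : ℝ} (hz : z ∈ Set.Icc (0 : ℝ) 1)
    (hdist : ((2 : ℝ) ^ k)⁻¹ / 8 ≤ |z - g x|) : epochGap κ c k ≤ |P.eta (x, z) - 1 / 2| := by
  refine le_trans ?_ (hP.noise (x, z) ⟨hx, hz⟩)
  unfold epochGap
  gcongr

theorem abs_interpolant_thresholds_sub_le (hd : 1 ≤ d) (hlam : 0 < lam) (hα : 0 < α)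
    (hP : InClass P lam α κ c g) (hy : AllDeviation P δ lam α y)
    (hF : 1 ≤ finalDepth y n δ lam α) (hlarge : ¬ 2 ^ (finalDepth y n δ lam α + 1) ≤ ⌈α⌉₊)
    (hx : x ∈ baseCube d) :
    |interpolant α (finalDepth y n δ lam α) (thresholds y n δ lam α) x - g x| ≤
      2 * bias d lam α (finalDepth y n δ lam α) := by
  have hT := mainLoop_finalDepth_eq y n δ hlam hα
  generalize finalDepth y n δ lam α = F at hT hF hlarge ⊢
  refine (abs_interpolant_sub_le F hlam.le hα hP.holder (fun a ha => ?_) hx).trans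
    (two_pow_mul_precision_add_le hd hlam.le hα F)
  obtain ⟨B, hB⟩ := exists_searchLine_of_mainLoop_eq_some hF hT ha
  have hgrid := gridPoint_mem_baseCube α F ha
  have hdev := hy F hF a ha
  rw [levelConf, if_neg hlarge] at hdev
  exact abs_lineSearch_sub_le (precision_pos hlam α F) (hP.isThreshold hgrid) hdev
    (hP.holder.mapsTo hgrid) hB

theorem abs_interpolant_thresholds_le (hlam : 0 < lam) (hα : 0 < α)
    (hF : 1 ≤ finalDepth y n δ lam α) (hx : x ∈ baseCube d) :
    |interpolant α (finalDepth y n δ lam α) (thresholds y n δ lam α) x| ≤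
      (2 : ℝ) ^ (strictFloor α * (d - 1)) := by
  have hT := mainLoop_finalDepth_eq y n δ hlam hα
  refine (abs_interpolant_le (C := 1) α _ (fun a ha => ?_) hx).trans_eq (mul_one _)
  obtain ⟨B, hB⟩ := exists_searchLine_of_mainLoop_eq_some hF hT ha
  obtain ⟨hnonneg, hle⟩ := mem_Icc_of_lineSearch_eq_some hB
  rwa [abs_of_nonneg hnonneg]

theorem abs_interpolant_thresholds_sub_lt (hd : 2 ≤ d) (hlam : 1 ≤ lam) (hα : 0 < α)
    (hP : InClass P lam α κ c g) (hy : AllDeviation P δ lam α y)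
    (hF : 1 ≤ finalDepth y n δ lam α) (hx : x ∈ baseCube d) :
    |interpolant α (finalDepth y n δ lam α) (thresholds y n δ lam α) x - g x| <
      4 * bias d lam α (finalDepth y n δ lam α) := by
  have hlam₀ : 0 < lam := by linarith
  have hbias := bias_pos d hlam₀ hα (finalDepth y n δ lam α)
  by_cases hsmall : 2 ^ (finalDepth y n δ lam α + 1) ≤ ⌈α⌉₊
  · have hval := abs_interpolant_thresholds_le hlam₀ hα hF hx
    have hle := two_pow_strictFloor_mul_le_bias hd hlam hα hsmall
    have hone : (1 : ℝ) ≤ (2 : ℝ) ^ (strictFloor α * (d - 1)) := one_le_pow₀ one_le_two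
    have hg : |g x| ≤ 1 := by
      obtain ⟨hnonneg, hle_one⟩ := hP.holder.mapsTo hx
      rwa [abs_of_nonneg hnonneg]
    linarith [abs_sub (interpolant α (finalDepth y n δ lam α) (thresholds y n δ lam α) x) (g x)]
  · linarith [abs_interpolant_thresholds_sub_le (by omega) hlam₀ hα hP hy hF hsmall hx]

theorem outputOne_subset (hd : 2 ≤ d) (hlam : 1 ≤ lam) (hα : 0 < α)
    (hP : InClass P lam α κ c g) (hy : AllDeviation P δ lam α y) :
    outputOne y n δ lam α ⊆ {x ∈ cube d | g x.1 < x.2} := by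
  rintro x ⟨hx, hF, hle⟩
  have herr := abs_lt.1 (abs_interpolant_thresholds_sub_lt hd hlam hα hP hy hF hx.1)
  exact ⟨hx, by linarith [herr.1]⟩

theorem outputZero_subset (hd : 2 ≤ d) (hlam : 1 ≤ lam) (hα : 0 < α)
    (hP : InClass P lam α κ c g) (hy : AllDeviation P δ lam α y) :
    outputZero y n δ lam α ⊆ {x ∈ cube d | x.2 < g x.1} := by
  rintro x ⟨hx, hF, hle⟩
  have herr := abs_lt.1 (abs_interpolant_thresholds_sub_lt hd hlam hα hP hy hF hx.1)
  exact ⟨hx, by linarith [herr.2]⟩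

theorem searchLine_terminates (hd : 2 ≤ d) (hn : 1 ≤ n) (hδ : 0 < δ) (hδ' : δ ≤ 1 / 2)
    (hlam : 1 ≤ lam) (hα : 0 < α) (hκ : 1 ≤ κ) (hc : 0 < c) (hP : InClass P lam α κ c g)
    (hy : AllDeviation P δ lam α y) (hl : 1 ≤ l)
    (hcost : (gridSize α l + 1) ^ (d - 1) *
      lineCost κ c (logBound n δ α) (numEpochs (precision lam α l)) ≤ n)
    {a : Fin (d - 1) → ℕ} (ha : a ∈ lineIndices d α l) {B : ℕ}
    (hB : lineCost κ c (logBound n δ α) (numEpochs (precision lam α l)) ≤ B) :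
    ∃ τ, (searchLine y δ lam α l a B).2 = some τ ∧ (searchLine y δ lam α l a B).1 ≤
      lineCost κ c (logBound n δ α) (numEpochs (precision lam α l)) :=
  have hgrid := gridPoint_mem_baseCube α l ha
  have hΛ := zero_lt_one.trans_le (one_le_logBound hn hδ hδ' hα.le)
  lineSearch_terminates (levelConf_pos d hδ α l) (levelConf_le_depthConf d hδ α l)
    (hP.isThreshold hgrid) (fun _ _ _ => hP.epochGap_le_abs_sub hκ hc.le hgrid)
    (fun k _ => one_le_epochRounds κ hc hΛ k) hB
    (fun _ hk => two_mul_conf_le_epochGap hd hn hδ hδ' hlam hα hc hk hcost) (hy l hl a ha)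

theorem le_finalDepth_of_totalCost_lt (hd : 2 ≤ d) (hn : 1 ≤ n) (hδ : 0 < δ) (hδ' : δ ≤ 1 / 2)
    (hlam : 1 ≤ lam) (hα : 0 < α) (hκ : 1 ≤ κ) (hc : 0 < c) (hP : InClass P lam α κ c g)
    (hy : AllDeviation P δ lam α y) {L : ℕ}
    (hcost : ∑ l ∈ Finset.range L, (gridSize α (l + 1) + 1) ^ (d - 1) *
      lineCost κ c (logBound n δ α) (numEpochs (precision lam α (l + 1))) < n) :
    L ≤ finalDepth y n δ lam α := by
  refine le_finalDepth (by linarith) hα (mainLoop_terminates (L := L)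
    (C := fun l => lineCost κ c (logBound n δ α) (numEpochs (precision lam α l)))
    (fun l hl hlL a ha B hB => ?_) hcost le_rfl).1
  refine searchLine_terminates hd hn hδ hδ' hlam hα hκ hc hP hy hl (le_trans ?_ hcost.le) ha hB
  obtain ⟨l, rfl⟩ := Nat.exists_eq_add_of_le' hl
  exact Finset.single_le_sum (f := fun l => (gridSize α (l + 1) + 1) ^ (d - 1) *
    lineCost κ c (logBound n δ α) (numEpochs (precision lam α (l + 1))))
    (fun _ _ => Nat.zero_le _) (Finset.mem_range.2 hlL)

theorem six_mul_bias_finalDepth_le_widthBound (hd : 2 ≤ d) (hn : 1 ≤ n) (hδ : 0 < δ)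
    (hδ' : δ ≤ 1 / 2) (hlam : 1 ≤ lam) (hα : 0 < α) (hκ : 1 < κ) (hc : 0 < c) (hc' : c ≤ 1 / 2)
    (hP : InClass P lam α κ c g) (hy : AllDeviation P δ lam α y) :
    6 * bias d lam α (finalDepth y n δ lam α) ≤ widthBound d n δ lam α κ c := by
  by_contra! hlt
  have hcost := totalCost_lt hd hn hδ hδ' (by linarith) hα hκ hc hc' hlt
  exact absurd (le_finalDepth_of_totalCost_lt hd hn hδ hδ' hlam hα hκ.le hc hP hy hcost)
    (Nat.not_succ_le_self _)

theorem abs_interpolant_thresholds_sub_le_of_bias_lt_one (hd : 2 ≤ d) (hlam : 1 ≤ lam)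
    (hα : 0 < α) (hP : InClass P lam α κ c g) (hy : AllDeviation P δ lam α y)
    (hbias : bias d lam α (finalDepth y n δ lam α) < 1) :
    1 ≤ finalDepth y n δ lam α ∧ ∀ x ∈ baseCube d,
      |interpolant α (finalDepth y n δ lam α) (thresholds y n δ lam α) x - g x| ≤
        2 * bias d lam α (finalDepth y n δ lam α) := by
  have hF : 1 ≤ finalDepth y n δ lam α := by
    by_contra! hzero
    rw [Nat.lt_one_iff.1 hzero] at hbias
    exact hbias.not_ge (one_le_bias_zero (by omega) hlam hα)
  have hlarge : ¬ 2 ^ (finalDepth y n δ lam α + 1) ≤ ⌈α⌉₊ := fun hsmall =>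
    hbias.not_ge ((one_le_pow₀ one_le_two).trans
      (two_pow_strictFloor_mul_le_bias hd hlam hα hsmall))
  exact ⟨hF, fun x hx => abs_interpolant_thresholds_sub_le (by omega) (by linarith) hα hP hy hF
    hlarge hx⟩

theorem subset_outputs (hd : 2 ≤ d) (hlam : 1 ≤ lam) (hα : 0 < α)
    (hP : InClass P lam α κ c g) (hy : AllDeviation P δ lam α y)
    (hbias : 6 * bias d lam α (finalDepth y n δ lam α) ≤ Δ) (hΔ : Δ < 1) :
    {x ∈ cube d | Δ < x.2 - g x.1} ⊆ outputOne y n δ lam α ∧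
      {x ∈ cube d | Δ < g x.1 - x.2} ⊆ outputZero y n δ lam α := by
  have hpos := bias_pos d (by linarith : 0 < lam) hα (finalDepth y n δ lam α)
  obtain ⟨hF, herr⟩ :=
    abs_interpolant_thresholds_sub_le_of_bias_lt_one (n := n) hd hlam hα hP hy (by linarith)
  constructor
  · rintro x ⟨hx, hlt⟩
    exact ⟨hx, hF, by linarith [(abs_le.1 (herr x.1 hx.1)).2]⟩
  · rintro x ⟨hx, hlt⟩
    exact ⟨hx, hF, by linarith [(abs_le.1 (herr x.1 hx.1)).1]⟩

theorem subset_outputs_of_one_le (hg : Set.MapsTo g (baseCube d) (Set.Icc 0 1)) (hΔ : 1 ≤ Δ) :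
    {x ∈ cube d | Δ < x.2 - g x.1} ⊆ outputOne y n δ lam α ∧
      {x ∈ cube d | Δ < g x.1 - x.2} ⊆ outputZero y n δ lam α := by
  constructor
  · rintro x ⟨hx, hlt⟩
    linarith [hx.2.2, (hg hx.1).1]
  · rintro x ⟨hx, hlt⟩
    linarith [hx.2.1, (hg hx.1).2]

theorem measurableSet_cube (d : ℕ) : MeasurableSet (cube d) :=
  (measurableSet_Icc (a := (0 : Fin (d - 1) → ℝ)) (b := 1)).prod measurableSet_Icc

theorem measurableSet_outputZero (y : Request d → Point d → Bool) (n : ℕ) (δ lam α : ℝ) :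
    MeasurableSet (outputZero y n δ lam α) :=
  (measurableSet_cube d).inter ((MeasurableSet.const _).inter (measurableSet_le measurable_snd
    (((measurable_interpolant α _ _).comp measurable_fst).sub_const _)))

theorem measurableSet_outputOne (y : Request d → Point d → Bool) (n : ℕ) (δ lam α : ℝ) :
    MeasurableSet (outputOne y n δ lam α) :=
  (measurableSet_cube d).inter ((MeasurableSet.const _).inter (measurableSet_le
    (((measurable_interpolant α _ _).comp measurable_fst).add_const _) measurable_snd))

theorem disjoint_outputs (y : Request d → Point d → Bool) (n : ℕ) (δ : ℝ) (hlam : 0 < lam)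
    (hα : 0 < α) : Disjoint (outputZero y n δ lam α) (outputOne y n δ lam α) := by
  rw [Set.disjoint_left]
  rintro x ⟨-, -, hle⟩ ⟨-, -, hge⟩
  linarith [bias_pos d hlam hα (finalDepth y n δ lam α)]

variable {Ω : Type*} [MeasurableSpace Ω] {μ : Measure Ω} {Y : Request d → Point d → Ω → Bool}

theorem isCorrect_of_measure_lt (hlam : 0 < lam) (hα : 0 < α) (hΔ : 0 ≤ Δ)
    (hprob : μ {ω | ¬ (labelsRequested (fun r x => Y r x ω) n δ lam α ≤ n ∧
      {x ∈ cube d | Δ < x.2 - g x.1} ⊆ outputOne (fun r x => Y r x ω) n δ lam α ∧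
      {x ∈ cube d | Δ < g x.1 - x.2} ⊆ outputZero (fun r x => Y r x ω) n δ lam α ∧
      outputOne (fun r x => Y r x ω) n δ lam α ⊆ {x ∈ cube d | g x.1 < x.2} ∧
      outputZero (fun r x => Y r x ω) n δ lam α ⊆ {x ∈ cube d | x.2 < g x.1})}
        < ENNReal.ofReal (2 * δ)) :
    IsCorrect μ
      (fun ω => outputZero (fun r x => Y r x ω) n δ lam α)
      (fun ω => outputOne (fun r x => Y r x ω) n δ lam α)
      (fun ω => labelsRequested (fun r x => Y r x ω) n δ lam α)
      g δ Δ n where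
  nonneg := hΔ
  subset_zero _ := fun _ hx => hx.1
  subset_one _ := fun _ hx => hx.1
  disjoint _ := disjoint_outputs _ _ _ hlam hα
  measurable_zero _ := measurableSet_outputZero _ _ _ _ _
  measurable_one _ := measurableSet_outputOne _ _ _ _ _
  prob := hprob

theorem isCorrect_of_one_half_lt [IsProbabilityMeasure μ] (hlam : 0 < lam) (hα : 0 < α)
    (hδ : 1 / 2 < δ) (hΔ : 0 ≤ Δ) :
    IsCorrect μ
      (fun ω => outputZero (fun r x => Y r x ω) n δ lam α)
      (fun ω => outputOne (fun r x => Y r x ω) n δ lam α)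
      (fun ω => labelsRequested (fun r x => Y r x ω) n δ lam α)
      g δ Δ n :=
  isCorrect_of_measure_lt hlam hα hΔ
    (prob_le_one.trans_lt (ENNReal.one_lt_ofReal.2 (by linarith)))

theorem IsLabelOracle.isCorrect_of_subset_outputs (hY : IsLabelOracle P μ Y)
    (hP : InClass P lam α κ c g) (hd : 2 ≤ d) (hδ : 0 < δ) (hδ' : δ ≤ 1) (hlam : 1 ≤ lam)
    (hα : 0 < α) (hΔ : 0 ≤ Δ)
    (hsub : ∀ y : Request d → Point d → Bool, AllDeviation P δ lam α y →
      {x ∈ cube d | Δ < x.2 - g x.1} ⊆ outputOne y n δ lam α ∧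
      {x ∈ cube d | Δ < g x.1 - x.2} ⊆ outputZero y n δ lam α) :
    IsCorrect μ
      (fun ω => outputZero (fun r x => Y r x ω) n δ lam α)
      (fun ω => outputOne (fun r x => Y r x ω) n δ lam α)
      (fun ω => labelsRequested (fun r x => Y r x ω) n δ lam α)
      g δ Δ n := by
  have hgood := hY.measure_not_allDeviation_le (by omega) hδ hδ' lam hα
  have hδ₂ : ENNReal.ofReal δ < ENNReal.ofReal (2 * δ) :=
    (ENNReal.ofReal_lt_ofReal_iff (by linarith)).2 (by linarith)
  refine isCorrect_of_measure_lt (by linarith) hα hΔ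
    ((measure_mono fun ω hω => ?_).trans_lt (hgood.trans_lt hδ₂))
  intro hdev
  exact hω ⟨mainLoop_fst_le _ _ _ _ _ _, (hsub _ hdev).1, (hsub _ hdev).2,
    outputOne_subset hd hlam hα hP hdev, outputZero_subset hd hlam hα hP hdev⟩

end Correctness

end ActiveLearning

theorem theorem4 {d : ℕ} (hd : 2 ≤ d) {lam α κ c δ : ℝ} {n : ℕ}
    (hlam : 1 ≤ lam) (hα : 0 < α) (hκ : 1 ≤ κ) (hc : 0 < c) (hc' : c ≤ 1 / 2)
    (hn : 1 ≤ n) (hδ : 0 < δ) (hδ' : δ < 1)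
    (P : ClassificationProblem d) (g : (Fin (d - 1) → ℝ) → ℝ) (hP : InClass P lam α κ c g)
    {Ω : Type*} [MeasurableSpace Ω] (μ : MeasureTheory.Measure Ω)
    [MeasureTheory.IsProbabilityMeasure μ]
    (Y : Request d → Point d → Ω → Bool) (hY : IsLabelOracle P μ Y) :
    ∃ Δ : ℝ,
      IsCorrect μ
        (fun ω => outputZero (fun r x => Y r x ω) n δ lam α)
        (fun ω => outputOne (fun r x => Y r x ω) n δ lam α)
        (fun ω => labelsRequested (fun r x => Y r x ω) n δ lam α)
        g δ Δ n ∧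
      (1 < κ → Δ ≤ widthBound d n δ lam α κ c) := by
  have hlam₀ : 0 < lam := by linarith
  by_cases hwidth : 1 < κ ∧ widthBound d n δ lam α κ c < 1
  · obtain ⟨hκ₁, hlt⟩ := hwidth
    have hnonneg := widthBound_nonneg d hn hδ hδ'.le hlam₀.le hα.le hκ₁.le hc (by linarith)
    refine ⟨widthBound d n δ lam α κ c, ?_, fun _ => le_rfl⟩
    rcases le_or_gt δ (1 / 2) with hhalf | hhalf
    · exact hY.isCorrect_of_subset_outputs hP hd hδ hδ'.le hlam hα hnonneg fun y hy =>
        subset_outputs hd hlam hα hP hy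
          (six_mul_bias_finalDepth_le_widthBound hd hn hδ hhalf hlam hα hκ₁ hc hc' hP hy) hlt
    · exact isCorrect_of_one_half_lt hlam₀ hα hhalf hnonneg
  · refine ⟨1, ?_, fun hκ₁ => not_lt.1 fun hlt => hwidth ⟨hκ₁, hlt⟩⟩
    exact hY.isCorrect_of_subset_outputs hP hd hδ hδ'.le hlam hα zero_le_one fun _ _ =>
      subset_outputs_of_one_le hP.holder.mapsTo le_rfl
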